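/- Let $r\ge 1$ and $n\ge 0$ be integers. Let $\mathfrak{gl}_r$ be the Lie algebra of complex $r\times r$ matrices, $\mathfrak b$ its subalgebra of upper triangular matrices, $\mathfrak h$ the subalgebra of diagonal matrices, $\varepsilon_1,\dots,\varepsilon_r\in\mathfrak h^*$ the coordinate functions $\varepsilon_i(h)=h_{ii}$, and $\omega_1=\varepsilon_1$. Extend each $\lambda\in\mathfrak h^*$ to $\mathfrak b$ by zero on strictly upper triangular matrices. A vector $v$ of a $\mathfrak{gl}_r\otimes\mathbb C[x]$-module is called a highest weight vector of weight $\lambda$ if $(g\otimes P)v=\lambda(g)P(0)v$ for all $g\in\mathfrak b$ and $P\in\mathbb C[x]$. Let $W^1(\lambda)$ be the (one-variable) Weyl module, that is, the universal finite-dimensional $\mathfrak{gl}_r\otimes\mathbb C[x]$-module generated by a highest weight vector of weight $\lambda$: every finite-dimensional module generated by a highest weight vector $v$ of weight $\lambda$ is a quotient of $W^1(\lambda)$, by a map that sends the generator to $v$. For $\mu\in\mathfrak h^*$ let $W^1(\lambda)^\mu$ be the subspace of all $w\in W^1(\lambda)$ such that $(h\otimes 1)w=\mu(h)w$ for all $h\in\mathfrak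 h$. Then $W^1(n\omega_1)$ exists and $$\dim W^1(n\omega_1)=r^n .$$ If $k_1,\dots,k_r$ are non-negative integers with $k_1+\dots+k_r=n$, then $$\dim W^1(n\omega_1)^{k_1\varepsilon_1+\dots+k_r\varepsilon_r}=\frac{n!}{k_1!\cdots k_r!},$$ and $W^1(n\omega_1)^\mu=0$ for every $\mu\in\mathfrak h^*$ that is not of this form. -/

import Mathlib

open scoped TensorProduct

attribute [local instance 100] LieRing.ofAssociativeRing
attribute [local instance 100] LieAlgebra.ofAssociativeAlgebra

noncomputable section

/-! ### Cyclic modules over a Lie algebra -/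

namespace CurrentWeyl

section Cyclic

variable {L : Type*} [LieRing L] [LieAlgebra ℂ L]

/-- For a left ideal `I` of the enveloping algebra `U(L)`, the Lie algebra `L` acts on `U(L) / I`
by left multiplication. -/
instance instLieRingModuleQuot
    (I : Submodule (UniversalEnvelopingAlgebra ℂ L) (UniversalEnvelopingAlgebra ℂ L)) :
    LieRingModule L (UniversalEnvelopingAlgebra ℂ L ⧸ I) where
  bracket x m := UniversalEnvelopingAlgebra.ι ℂ x • m
  add_lie x y m := by
    rw [map_add, add_smul]
  lie_add x m n := smul_add _ m n
  leibniz_lie x y m := by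
    change UniversalEnvelopingAlgebra.ι ℂ x • UniversalEnvelopingAlgebra.ι ℂ y • m =
      UniversalEnvelopingAlgebra.ι ℂ ⁅x, y⁆ • m +
        UniversalEnvelopingAlgebra.ι ℂ y • UniversalEnvelopingAlgebra.ι ℂ x • m
    rw [LieHom.map_lie, LieRing.of_associative_ring_bracket, sub_smul, mul_smul, mul_smul]
    abel

theorem lie_quot_def
    (I : Submodule (UniversalEnvelopingAlgebra ℂ L) (UniversalEnvelopingAlgebra ℂ L))
    (x : L) (m : UniversalEnvelopingAlgebra ℂ L ⧸ I) :
    ⁅x, m⁆ = UniversalEnvelopingAlgebra.ι ℂ x • m := rfl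

instance instLieModuleQuot
    (I : Submodule (UniversalEnvelopingAlgebra ℂ L) (UniversalEnvelopingAlgebra ℂ L)) :
    LieModule ℂ L (UniversalEnvelopingAlgebra ℂ L ⧸ I) where
  smul_lie c x m := by
    rw [lie_quot_def, lie_quot_def, map_smul, smul_assoc]
  lie_smul c x m := by
    rw [lie_quot_def, lie_quot_def, smul_algebra_smul_comm]

end Cyclic

/-! ### Highest weight vectors, weight spaces and Weyl modules for `𝔤 ⊗ A` -/

section Weyl

variable (A : Type*) [CommRing A] [Algebra ℂ A] (ε : A →ₐ[ℂ] ℂ)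
  {g : Type*} [LieRing g] [LieAlgebra ℂ g]

/-- The Lie algebra `𝔤 ⊗ A`, with bracket `[P ⊗ x, Q ⊗ y] = P Q ⊗ [x, y]`. -/
abbrev Current (g : Type*) [LieRing g] [LieAlgebra ℂ g] : Type _ := A ⊗[ℂ] g

variable {A}

/-- `v` is a highest weight vector of weight `χ` for `𝔤 ⊗ A`: `(x ⊗ P) v = χ(x) ε(P) v` for
all `x` in the Borel subalgebra `b` and all `P` in `A`. A weight `χ` is here a linear function on
`b`; for a weight `λ` of the Cartan subalgebra one takes the extension of `λ` to `b` by zero on the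
nilpotent radical. -/
def IsHighestWeightVector {b : LieSubalgebra ℂ g} (χ : b →ₗ[ℂ] ℂ)
    {M : Type*} [AddCommGroup M] [Module ℂ M] [LieRingModule (Current A g) M] (v : M) : Prop :=
  ∀ (x : b) (P : A), ⁅(P ⊗ₜ[ℂ] (x : g) : Current A g), v⁆ = (χ x * ε P) • v

/-- The left ideal of `U(𝔤 ⊗ A)` that defines the Weyl module: the intersection of all left ideals
`I` such that `U(𝔤 ⊗ A) / I` is a finite-dimensional module in which the class of `1` is a highest
weight vector of weight `χ`. -/
def weylIdeal {b : LieSubalgebra ℂ g} (χ : b →ₗ[ℂ] ℂ) :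
    Submodule (UniversalEnvelopingAlgebra ℂ (Current A g))
      (UniversalEnvelopingAlgebra ℂ (Current A g)) :=
  sInf {I | Module.Finite ℂ (UniversalEnvelopingAlgebra ℂ (Current A g) ⧸ I) ∧
    IsHighestWeightVector ε χ (I.mkQ 1)}

/-- The Weyl module `W^A_ε(χ)`: the universal module through which every finite-dimensional module
generated by a highest weight vector of weight `χ` factors (see `weylModule_universal`).
It is the universal finite-dimensional such module as soon as it is finite-dimensional. -/
abbrev WeylModule {b : LieSubalgebra ℂ g} (χ : b →ₗ[ℂ] ℂ) : Type _ :=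
  UniversalEnvelopingAlgebra ℂ (Current A g) ⧸ weylIdeal ε χ

/-- The generating highest weight vector of the Weyl module. -/
def weylVector {b : LieSubalgebra ℂ g} (χ : b →ₗ[ℂ] ℂ) : WeylModule ε χ :=
  (weylIdeal ε χ).mkQ 1

theorem isHighestWeightVector_mkQ_iff {b : LieSubalgebra ℂ g} (χ : b →ₗ[ℂ] ℂ)
    (I : Submodule (UniversalEnvelopingAlgebra ℂ (Current A g))
      (UniversalEnvelopingAlgebra ℂ (Current A g))) :
    IsHighestWeightVector ε χ (I.mkQ 1) ↔ ∀ (x : b) (P : A),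
      UniversalEnvelopingAlgebra.ι ℂ (P ⊗ₜ[ℂ] (x : g) : Current A g) -
        algebraMap ℂ _ (χ x * ε P) ∈ I := by
  refine forall_congr' fun x => forall_congr' fun P => ?_
  rw [lie_quot_def, ← map_smul, ← sub_eq_zero, ← Submodule.Quotient.mk_eq_zero,
    Submodule.Quotient.mk_sub, Algebra.algebraMap_eq_smul_one, Submodule.Quotient.mk_smul]
  simp

theorem weylVector_isHighestWeightVector {b : LieSubalgebra ℂ g} (χ : b →ₗ[ℂ] ℂ) :
    IsHighestWeightVector ε χ (weylVector ε χ) := by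
  refine (isHighestWeightVector_mkQ_iff ε χ _).2 fun x P => ?_
  refine Submodule.mem_sInf.2 fun I hI => ?_
  exact (isHighestWeightVector_mkQ_iff ε χ I).1 hI.2 x P

/-- The Weyl module is generated by its highest weight vector. -/
theorem lieSpan_weylVector {b : LieSubalgebra ℂ g} (χ : b →ₗ[ℂ] ℂ) :
    LieSubmodule.lieSpan ℂ (Current A g) {weylVector ε χ} = ⊤ := by
  set N := LieSubmodule.lieSpan ℂ (Current A g) {weylVector ε χ} with hN
  let S : Subalgebra ℂ (UniversalEnvelopingAlgebra ℂ (Current A g)) :=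
    { carrier := {u | ∀ m ∈ N, u • m ∈ N}
      mul_mem' := by
        intro a c ha hc m hm
        rw [mul_smul]
        exact ha _ (hc _ hm)
      add_mem' := by
        intro a c ha hc m hm
        rw [add_smul]
        exact N.add_mem (ha _ hm) (hc _ hm)
      algebraMap_mem' := by
        intro c m hm
        rw [algebraMap_smul]
        exact N.smul_mem c hm }
  have hS : ∀ x : Current A g, UniversalEnvelopingAlgebra.ι ℂ x ∈ S :=
    fun x m hm => N.lie_mem (x := x) hm
  let j : Current A g →ₗ⁅ℂ⁆ S :=
    { toFun := fun x => ⟨UniversalEnvelopingAlgebra.ι ℂ x, hS x⟩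
      map_add' := fun x y => Subtype.ext (map_add _ x y)
      map_smul' := fun c x => Subtype.ext (map_smul _ c x)
      map_lie' := fun {x y} => Subtype.ext (LieHom.map_lie _ x y) }
  have hid : S.val.comp (UniversalEnvelopingAlgebra.lift ℂ j) =
      AlgHom.id ℂ (UniversalEnvelopingAlgebra ℂ (Current A g)) := by
    apply UniversalEnvelopingAlgebra.hom_ext
    ext x
    change ((UniversalEnvelopingAlgebra.lift ℂ j (UniversalEnvelopingAlgebra.ι ℂ x) : S) :
      UniversalEnvelopingAlgebra ℂ (Current A g)) = UniversalEnvelopingAlgebra.ι ℂ x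
    rw [UniversalEnvelopingAlgebra.lift_ι_apply]
    rfl
  have hall : ∀ u, u ∈ S := fun u => by
    have := (UniversalEnvelopingAlgebra.lift ℂ j u).2
    rwa [show ((UniversalEnvelopingAlgebra.lift ℂ j u : S) :
      UniversalEnvelopingAlgebra ℂ (Current A g)) = u from DFunLike.congr_fun hid u] at this
  rw [eq_top_iff]
  intro m _
  obtain ⟨u, rfl⟩ := (weylIdeal ε χ).mkQ_surjective m
  have h := hall u (weylVector ε χ) (LieSubmodule.subset_lieSpan rfl)
  rwa [weylVector, ← map_smul, smul_eq_mul, mul_one] at h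

/-- Every finite-dimensional module generated by a highest weight vector of weight `χ` is a
quotient of the Weyl module. -/
theorem weylModule_universal {b : LieSubalgebra ℂ g} (χ : b →ₗ[ℂ] ℂ)
    {M : Type*} [AddCommGroup M] [Module ℂ M] [LieRingModule (Current A g) M]
    [LieModule ℂ (Current A g) M] [Module.Finite ℂ M] (v : M)
    (hv : IsHighestWeightVector ε χ v)
    (hgen : LieSubmodule.lieSpan ℂ (Current A g) {v} = ⊤) :
    ∃ f : WeylModule ε χ →ₗ⁅ℂ, Current A g⁆ M,
      f (weylVector ε χ) = v ∧ Function.Surjective f := by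
  let ρ : UniversalEnvelopingAlgebra ℂ (Current A g) →ₐ[ℂ] Module.End ℂ M :=
    UniversalEnvelopingAlgebra.lift ℂ (LieModule.toEnd ℂ (Current A g) M)
  have hρ : ∀ (x : Current A g) (m : M), ρ (UniversalEnvelopingAlgebra.ι ℂ x) m = ⁅x, m⁆ := by
    intro x m
    change (UniversalEnvelopingAlgebra.lift ℂ (LieModule.toEnd ℂ (Current A g) M)
      (UniversalEnvelopingAlgebra.ι ℂ x)) m = _
    rw [UniversalEnvelopingAlgebra.lift_ι_apply]; rfl
  let F : UniversalEnvelopingAlgebra ℂ (Current A g) →ₗ[ℂ] M :=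
    (LinearMap.applyₗ v).comp ρ.toLinearMap
  have hF : ∀ u, F u = ρ u v := fun u => rfl
  let I : Submodule (UniversalEnvelopingAlgebra ℂ (Current A g))
      (UniversalEnvelopingAlgebra ℂ (Current A g)) :=
    { carrier := {u | ρ u v = 0}
      add_mem' := by intro a b ha hb; simp_all
      zero_mem' := by simp
      smul_mem' := by intro c x hx; simp_all }
  have hI : ∀ u, u ∈ I ↔ F u = 0 := fun u => Iff.rfl
  have hfin : Module.Finite ℂ (UniversalEnvelopingAlgebra ℂ (Current A g) ⧸ I) := by
    let G : (UniversalEnvelopingAlgebra ℂ (Current A g) ⧸ I) →ₗ[ℂ] M :=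
      (I.restrictScalars ℂ).liftQ F (fun u hu => hu)
    refine Module.Finite.of_injective G ?_
    rw [← LinearMap.ker_eq_bot]
    exact Submodule.ker_liftQ_eq_bot _ _ _ (fun u hu => hu)
  have hhw : IsHighestWeightVector ε χ (I.mkQ 1) := by
    refine (isHighestWeightVector_mkQ_iff ε χ I).2 fun x P => ?_
    rw [hI, hF, map_sub, LinearMap.sub_apply, hρ, hv x P, AlgHom.commutes]
    rw [Module.algebraMap_end_apply, sub_self]
  have hle : weylIdeal ε χ ≤ I := sInf_le ⟨hfin, hhw⟩
  let G : WeylModule ε χ →ₗ[ℂ] M :=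
    ((weylIdeal ε χ).restrictScalars ℂ).liftQ F (fun u hu => hle hu)
  have hG : ∀ u, G ((weylIdeal ε χ).mkQ u) = ρ u v := fun u => rfl
  let f : WeylModule ε χ →ₗ⁅ℂ, Current A g⁆ M :=
    { G with
      map_lie' := by
        intro x m
        obtain ⟨u, rfl⟩ := (weylIdeal ε χ).mkQ_surjective m
        change G (UniversalEnvelopingAlgebra.ι ℂ x • (weylIdeal ε χ).mkQ u) =
          ⁅x, G ((weylIdeal ε χ).mkQ u)⁆
        rw [← map_smul, hG, hG, smul_eq_mul, map_mul, Module.End.mul_apply, hρ] }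
  have h1 : f (weylVector ε χ) = v := by
    change G ((weylIdeal ε χ).mkQ 1) = v
    rw [hG, map_one, Module.End.one_apply]
  refine ⟨f, h1, ?_⟩
  rw [← LieModuleHom.range_eq_top, eq_top_iff, ← hgen, LieSubmodule.lieSpan_le]
  rintro _ rfl
  exact (LieModuleHom.mem_range _ _).2 ⟨_, h1⟩

/-- The weight space `M^μ` of a `𝔤 ⊗ A`-module `M`: the common eigenspace of the Cartan subalgebra
`h = h ⊗ 1` on which `x ∈ h` acts by the scalar `μ(x)`. -/
def weightSpace (A : Type*) [CommRing A] [Algebra ℂ A] {h : LieSubalgebra ℂ g}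
    (M : Type*) [AddCommGroup M] [Module ℂ M]
    [LieRingModule (Current A g) M] [LieModule ℂ (Current A g) M] (μ : Module.Dual ℂ h) :
    Submodule ℂ M :=
  ⨅ x : h, Module.End.eigenspace
    (LieModule.toEnd ℂ (Current A g) M ((1 : A) ⊗ₜ[ℂ] (x : g))) (μ x)

theorem mem_weightSpace {h : LieSubalgebra ℂ g}
    {M : Type*} [AddCommGroup M] [Module ℂ M]
    [LieRingModule (Current A g) M] [LieModule ℂ (Current A g) M] (μ : Module.Dual ℂ h) (m : M) :
    m ∈ weightSpace A M μ ↔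
      ∀ x : h, ⁅((1 : A) ⊗ₜ[ℂ] (x : g) : Current A g), m⁆ = μ x • m := by
  simp [weightSpace, Submodule.mem_iInf]

end Weyl

/-! ### The case of `𝔤𝔩_r` -/

section GeneralLinear

/-- The Lie algebra `𝔤𝔩_r` of complex `r × r` matrices with the commutator bracket. -/
abbrev gl (r : ℕ) : Type := Matrix (Fin r) (Fin r) ℂ

/-- The standard Borel subalgebra of `𝔤𝔩_r`: upper triangular matrices. -/
def borel (r : ℕ) : LieSubalgebra ℂ (gl r) where
  carrier := {x | ∀ i j, j < i → x i j = 0}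
  add_mem' := by
    intro x y hx hy i j hij
    simp [hx i j hij, hy i j hij]
  zero_mem' := by intro i j _; rfl
  smul_mem' := by
    intro c x hx i j hij
    simp [hx i j hij]
  lie_mem' := by
    intro x y hx hy
    have hx' : Matrix.BlockTriangular x id := fun i j hij => hx i j hij
    have hy' : Matrix.BlockTriangular y id := fun i j hij => hy i j hij
    intro i j hij
    exact ((hx'.mul hy').sub (hy'.mul hx')) hij

/-- The standard Cartan subalgebra of `𝔤𝔩_r`: diagonal matrices. -/
def cartan (r : ℕ) : LieSubalgebra ℂ (gl r) where
  carrier := {x | x.IsDiag}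
  add_mem' := fun hx hy => hx.add hy
  zero_mem' := Matrix.isDiag_zero
  smul_mem' := fun c _ hx => hx.smul c
  lie_mem' := by
    intro x y hx hy
    have hx' : Matrix.diagonal (Matrix.diag x) = x := hx.diagonal_diag
    have hy' : Matrix.diagonal (Matrix.diag y) = y := hy.diagonal_diag
    change (x * y - y * x).IsDiag
    rw [← hx', ← hy', Matrix.diagonal_mul_diagonal, Matrix.diagonal_mul_diagonal]
    exact (Matrix.isDiag_diagonal _).sub (Matrix.isDiag_diagonal _)

/-- The diagonal part of an upper triangular matrix: the projection of the Borel subalgebra onto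
the Cartan subalgebra along the strictly upper triangular matrices. -/
def diagPart (r : ℕ) : borel r →ₗ[ℂ] cartan r where
  toFun x := ⟨Matrix.diagonal (Matrix.diag (x : gl r)), Matrix.isDiag_diagonal _⟩
  map_add' x y := by ext i j; simp [Matrix.diagonal_apply]; split <;> simp
  map_smul' c x := by ext i j; simp [Matrix.diagonal_apply]

/-- The standard basis `ε_1, …, ε_r` of the weight space of `𝔤𝔩_r`: `ε_i(x) = x_{ii}`. -/
def epsilon {r : ℕ} (i : Fin r) : Module.Dual ℂ (cartan r) where
  toFun x := (x : gl r) i i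
  map_add' _ _ := rfl
  map_smul' _ _ := rfl

/-- The first fundamental weight `ω_1 = ε_1` of `𝔤𝔩_r`, `r ≥ 1`. -/
def omegaOne (r : ℕ) [NeZero r] : Module.Dual ℂ (cartan r) := epsilon 0

/-- The augmentation `P ↦ P(0)` of `ℂ[x]`. -/
def evalZero : Polynomial ℂ →ₐ[ℂ] ℂ := Polynomial.aeval (0 : ℂ)

/-- The one-variable Weyl module `W^1(λ)` for `𝔤𝔩_r`: the Weyl module of `𝔤𝔩_r ⊗ ℂ[x]` with
`ε(P) = P(0)` and highest weight `λ ∈ 𝔥^*`. -/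
abbrev WeylOne (r : ℕ) (lam : Module.Dual ℂ (cartan r)) : Type :=
  WeylModule evalZero (lam ∘ₗ diagPart r)

end GeneralLinear

end CurrentWeyl

end

namespace CurrentWeyl

/-! ### Algebras generated by the coefficients of a factorization of `1` -/

section Factorization

variable {ι : Type*}

/-! Two bounds meet. The part of weight `∑ k_i ε_i` has dimension at most the multinomial
coefficient of `k`, and these coefficients add up to `r ^ n`. On the other hand some
finite-dimensional quotient has dimension at least `r ^ n`. Hence every bound is an equality.

Upper bound. By `sl₂`-theory every `x^p e_{ab}` with `b ≠ 0` kills the generator `v`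
(`isExtremal_weylVector`; indices start at 0), so the operators `x^p e_{i0}` with `i ≠ 0` alone
produce the module from `v` (`IsExtremal.eq_top`). As `[x^s e_{ii}, e_{i0}] = x^s e_{i0}`, powers of
`x` can be shifted to diagonal operators. The part of weight `k` is therefore generated by the
single vector `∏ e_{i0}^{k_i} v` over the commutative algebra of the `x^s e_{ii}`
(`IsExtremal.lower_mem_weightPart`). On that part `x^s e_{ii}` behaves like the `s`-th power sum of
`k_i` points. Each `e_{i0}` adds one point (`newtonSeq_succ_mul`), so elementary symmetric functions
of degree above `k_i` vanish; for `i = 0` this is seen from a reflected generator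
(`IsExtremal.reflect`). The power sums of all points together vanish in positive degree, because
`x^s ⊗ 1` is central and kills `v` for `s > 0`. So the algebra that acts is a quotient of the ring
generated by the coefficients of polynomials of degrees `k_i`, with constant terms 1 and product 1,
which is the cohomology ring of a partial flag variety. `finrank_le_multinomial` bounds its
dimension.

Lower bound. On `(ℂ^r)^{⊗ n} ⊗ ℂ[t]` let `x` act on the `j`-th factor by `j t`. These points are
distinct for generic `t`, so by interpolation the lattice generated by `e_1 ⊗ ⋯ ⊗ e_1` has full rank
`r ^ n`. At `t = 0` all points collide at 0, and the lattice specializes to a cyclic highest weight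
module of weight `n ω_1` and the same dimension (`exists_ideal_finrank_eq`). -/

theorem coeff_prod_of_natDegree_le' {B : Type*} [CommRing B] (s : Finset ι)
    (q : ι → Polynomial B) (k : ι → ℕ) (hq : ∀ i ∈ s, (q i).natDegree ≤ k i) :
    (∏ i ∈ s, q i).coeff (∑ i ∈ s, k i) = ∏ i ∈ s, (q i).coeff (k i) := by
  classical
  induction s using Finset.induction_on with
  | empty => simp
  | insert a s ha ih =>
    rw [Finset.prod_insert ha, Finset.prod_insert ha, Finset.sum_insert ha,
      Polynomial.coeff_mul_add_eq_of_natDegree_le (hq a (by simp)),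
      ih fun i hi => hq i (Finset.mem_insert_of_mem hi)]
    exact (Polynomial.natDegree_prod_le _ _).trans
      (Finset.sum_le_sum fun i hi => hq i (Finset.mem_insert_of_mem hi))

/-- `dim B/(ab) ≤ dim B/(a) + dim B/(b)`. -/
theorem finrank_quotient_span_mul_le {B : Type*} [CommRing B] [Algebra ℂ B] (a b : B)
    (ha : Module.Finite ℂ (B ⧸ Ideal.span {a})) (hb : Module.Finite ℂ (B ⧸ Ideal.span {b})) :
    Module.Finite ℂ (B ⧸ Ideal.span {a * b}) ∧
      Module.finrank ℂ (B ⧸ Ideal.span {a * b}) ≤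
        Module.finrank ℂ (B ⧸ Ideal.span {a}) + Module.finrank ℂ (B ⧸ Ideal.span {b}) := by
  have hle : Ideal.span {a * b} ≤ Ideal.span {a} := by
    rw [Ideal.span_singleton_le_span_singleton]
    exact dvd_mul_right a b
  let p : (B ⧸ Ideal.span {a * b}) →ₗ[ℂ] (B ⧸ Ideal.span {a}) :=
    (Ideal.Quotient.factorₐ ℂ hle).toLinearMap
  let m : (B ⧸ Ideal.span {b}) →ₗ[ℂ] (B ⧸ Ideal.span {a * b}) :=
    ((Ideal.span {b}).restrictScalars ℂ).liftQ
      ((Ideal.Quotient.mkₐ ℂ (Ideal.span {a * b})).toLinearMap ∘ₗ LinearMap.mulLeft ℂ a) (by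
        intro x hx
        obtain ⟨c, rfl⟩ := Ideal.mem_span_singleton'.1 hx
        change Ideal.Quotient.mk _ (a * (c * b)) = 0
        rw [Ideal.Quotient.eq_zero_iff_mem, Ideal.mem_span_singleton']
        exact ⟨c, by ring⟩)
  have hm : ∀ x, m (Ideal.Quotient.mk _ x) = Ideal.Quotient.mk _ (a * x) := fun x => rfl
  have hp : ∀ x, p (Ideal.Quotient.mk _ x) = Ideal.Quotient.mk _ x := fun x => rfl
  -- Exactness of `B/(b) → B/(ab) → B/(a)`, where the first map is multiplication by `a`.
  have hker : LinearMap.ker p = LinearMap.range m := by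
    apply le_antisymm
    · intro x hx
      obtain ⟨x, rfl⟩ := Ideal.Quotient.mk_surjective x
      rw [LinearMap.mem_ker, hp, Ideal.Quotient.eq_zero_iff_mem, Ideal.mem_span_singleton'] at hx
      obtain ⟨c, rfl⟩ := hx
      exact ⟨Ideal.Quotient.mk _ c, by rw [hm, mul_comm a c]⟩
    · rintro _ ⟨x, rfl⟩
      obtain ⟨x, rfl⟩ := Ideal.Quotient.mk_surjective x
      rw [LinearMap.mem_ker, hm, hp, Ideal.Quotient.eq_zero_iff_mem, Ideal.mem_span_singleton']
      exact ⟨x, mul_comm _ _⟩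
  have hps : Function.Surjective p := Ideal.Quotient.factor_surjective hle
  have hfin : Module.Finite ℂ (B ⧸ Ideal.span {a * b}) := by
    have h1 : Module.Finite ℂ (LinearMap.ker p) := by
      rw [hker]; infer_instance
    have h2 : Module.Finite ℂ ((B ⧸ Ideal.span {a * b}) ⧸ LinearMap.ker p) :=
      Module.Finite.equiv (p.quotKerEquivOfSurjective hps).symm
    exact Module.Finite.of_submodule_quotient (LinearMap.ker p)
  refine ⟨hfin, ?_⟩
  rw [← p.finrank_range_add_finrank_ker, LinearMap.range_eq_top.2 hps, finrank_top, hker]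
  exact Nat.add_le_add_left m.finrank_range_le _

theorem finrank_quotient_span_prod_le {B : Type*} [CommRing B] [Algebra ℂ B] (s : Finset ι)
    (t : ι → B) (ht : ∀ i ∈ s, Module.Finite ℂ (B ⧸ Ideal.span {t i})) :
    Module.Finite ℂ (B ⧸ Ideal.span {∏ i ∈ s, t i}) ∧
      Module.finrank ℂ (B ⧸ Ideal.span {∏ i ∈ s, t i}) ≤
        ∑ i ∈ s, Module.finrank ℂ (B ⧸ Ideal.span {t i}) := by
  classical
  induction s using Finset.induction_on with
  | empty =>
    have : Subsingleton (B ⧸ Ideal.span {∏ i ∈ (∅ : Finset ι), t i}) :=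
      Ideal.Quotient.subsingleton_iff.2 (by simp)
    exact ⟨inferInstance, by rw [Module.finrank_zero_of_subsingleton]; simp⟩
  | insert a s ha ih =>
    obtain ⟨h1, h2⟩ := ih fun i hi => ht i (Finset.mem_insert_of_mem hi)
    obtain ⟨h3, h4⟩ := finrank_quotient_span_mul_le (t a) (∏ i ∈ s, t i) (ht a (by simp)) h1
    rw [Finset.prod_insert ha, Finset.sum_insert ha]
    exact ⟨h3, h4.trans (Nat.add_le_add_left h2 _)⟩

variable [Fintype ι] [DecidableEq ι]

/-- Pascal's rule: with `N = ∑ k i`, multiplication by `∏ (k i)!` turns the `i`-th term into `k i *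
(N - 1)!`, and these add up to `N!`. The terms with `k i = 0` are set to 0 because truncated
subtraction would leave `k` unchanged there. -/
theorem multinomial_eq_sum_sub_single (k : ι → ℕ) (hk : 0 < ∑ i, k i) :
    Nat.multinomial Finset.univ k =
      ∑ i, if k i = 0 then 0 else Nat.multinomial Finset.univ (k - Pi.single i 1) := by
  have hP : 0 < ∏ i, (k i).factorial := Finset.prod_pos fun i _ => Nat.factorial_pos _
  apply Nat.eq_of_mul_eq_mul_left hP
  rw [Nat.multinomial_spec, Finset.mul_sum]
  have key : ∀ i, (∏ i, (k i).factorial) *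
      (if k i = 0 then 0 else Nat.multinomial Finset.univ (k - Pi.single i 1)) =
        k i * (∑ i, k i - 1).factorial := by
    intro i
    split_ifs with h
    · simp [h]
    · have hs : ∑ j, (k - Pi.single i 1 : ι → ℕ) j = ∑ i, k i - 1 := by
        have : k = (k - Pi.single i 1) + Pi.single i 1 := by
          ext j
          by_cases hj : j = i
          · subst hj; simp; omega
          · simp [hj]
        conv_rhs => rw [this]
        simp [Finset.sum_add_distrib]
      rw [← hs, ← Nat.multinomial_spec, ← mul_assoc]
      congr 1
      rw [← Finset.mul_prod_erase _ _ (Finset.mem_univ i),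
        ← Finset.mul_prod_erase (a := i) _ _ (Finset.mem_univ i), ← mul_assoc]
      congr 1
      · simp [Nat.mul_factorial_pred h]
      · refine Finset.prod_congr rfl fun j hj => ?_
        simp [Finset.ne_of_mem_erase hj]
  rw [Finset.sum_congr rfl fun i _ => key i, ← Finset.sum_mul, Nat.mul_factorial_pred hk.ne']

/-- An algebra generated by the coefficients of polynomials `q i` of degree at most `k i` with
constant term `1` and product `1` has dimension at most the multinomial coefficient of `k`. -/
theorem finrank_le_multinomial (n : ℕ) :
    ∀ {B : Type*} [CommRing B] [Algebra ℂ B] (q : ι → Polynomial B) (k : ι → ℕ),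
      ∑ i, k i = n → (∀ i, (q i).natDegree ≤ k i) → (∀ i, (q i).coeff 0 = 1) →
      ∏ i, q i = 1 →
      Algebra.adjoin ℂ (Set.range fun x : ι × ℕ => (q x.1).coeff x.2) = ⊤ →
      Module.Finite ℂ B ∧ Module.finrank ℂ B ≤ Nat.multinomial Finset.univ k := by
  induction n with
  | zero =>
    intro B _ _ q k hk hdeg hone hprod hgen
    have hk0 : ∀ i, k i = 0 := by simpa using hk
    have hbot : (⊤ : Subalgebra ℂ B) = ⊥ := by
      rw [← hgen, eq_bot_iff, Algebra.adjoin_le_iff]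
      rintro _ ⟨⟨i, c⟩, rfl⟩
      rcases Nat.eq_zero_or_pos c with rfl | hc
      · simp only [hone]
        exact one_mem _
      · have : (q i).coeff c = 0 :=
          Polynomial.coeff_eq_zero_of_natDegree_lt ((hdeg i).trans_lt (by simpa [hk0] using hc))
        simp only [this]
        exact zero_mem _
    have hsurj : Function.Surjective (Algebra.linearMap ℂ B) := fun b => by
      have : b ∈ (⊥ : Subalgebra ℂ B) := hbot ▸ Algebra.mem_top
      exact Algebra.mem_bot.1 this
    refine ⟨Module.Finite.of_surjective _ hsurj, ?_⟩
    have h1 := (Algebra.linearMap ℂ B).finrank_range_le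
    rw [LinearMap.range_eq_top.2 hsurj, finrank_top, Module.finrank_self] at h1
    exact h1.trans (Nat.multinomial_pos _ _)
  | succ n ih =>
    intro B _ _ q k hk hdeg hone hprod hgen
    let t : ι → B := fun i => (q i).coeff (k i)
    -- The product of the leading coefficients is the coefficient of `∏ q i = 1` in degree `n + 1 >
    -- 0`.
    have ht : ∏ i, t i = 0 := by
      rw [← coeff_prod_of_natDegree_le' _ _ _ fun i _ => hdeg i, hprod, hk,
        Polynomial.coeff_one, if_neg (Nat.succ_ne_zero n)]
    -- Modulo `t i` the degree bound of `q i` drops by one, so induction applies. If `k i = 0`, then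
    -- `t i` is the constant term 1 and the quotient is zero.
    have hstep : ∀ i, Module.Finite ℂ (B ⧸ Ideal.span {t i}) ∧
        Module.finrank ℂ (B ⧸ Ideal.span {t i}) ≤
          if k i = 0 then 0 else Nat.multinomial Finset.univ (k - Pi.single i 1) := by
      intro i
      split_ifs with hi
      · have : Subsingleton (B ⧸ Ideal.span {t i}) :=
          Ideal.Quotient.subsingleton_iff.2 (by simp [t, hi, hone])
        exact ⟨inferInstance, by rw [Module.finrank_zero_of_subsingleton]⟩
      · let π : B →ₐ[ℂ] B ⧸ Ideal.span {t i} := Ideal.Quotient.mkₐ ℂ _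
        have hπ : Function.Surjective π := Ideal.Quotient.mk_surjective
        have hti : π (t i) = 0 :=
          Ideal.Quotient.eq_zero_iff_mem.2 (Ideal.mem_span_singleton_self _)
        refine ih (fun j => (q j).map (π : B →+* B ⧸ Ideal.span {t i})) _ ?_ ?_ ?_ ?_ ?_
        · have hadd : k = (k - Pi.single i 1) + Pi.single i 1 := by
            ext j
            by_cases hj : j = i
            · subst hj; simp; omega
            · simp [hj]
          rw [hadd] at hk
          simp only [Pi.add_apply, Finset.sum_add_distrib, Finset.sum_pi_single',
            Finset.mem_univ, if_true] at hk
          omega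
        · intro j
          by_cases hj : j = i
          · subst hj
            rw [Polynomial.natDegree_le_iff_coeff_eq_zero]
            intro N hN
            simp only [Pi.sub_apply, Pi.single_eq_same] at hN
            rw [Polynomial.coeff_map]
            rcases eq_or_ne N (k j) with rfl | hne
            · exact hti
            · rw [Polynomial.coeff_eq_zero_of_natDegree_lt ((hdeg j).trans_lt (by omega)),
                map_zero]
          · simpa [hj] using Polynomial.natDegree_map_le.trans (hdeg j)
        · intro j
          rw [Polynomial.coeff_map, hone, map_one]
        · rw [← Polynomial.map_prod, hprod, Polynomial.map_one]
        · have h1 := congrArg (Subalgebra.map π) hgen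
          rw [AlgHom.map_adjoin, Algebra.map_top, (AlgHom.range_eq_top π).2 hπ, ← Set.range_comp]
            at h1
          rw [← h1]
          congr 2
          ext x
          simp [Polynomial.coeff_map]
    obtain ⟨h1, h2⟩ := finrank_quotient_span_prod_le Finset.univ t fun i _ => (hstep i).1
    have hbot : Ideal.span {∏ i, t i} = (⊥ : Ideal B) := by rw [ht]; simp
    let e : (B ⧸ Ideal.span {∏ i, t i}) ≃ₗ[ℂ] B :=
      ((Ideal.quotientEquivAlgOfEq ℂ hbot).trans (AlgEquiv.quotientBot ℂ B)).toLinearEquiv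
    refine ⟨Module.Finite.equiv e, ?_⟩
    rw [← e.finrank_eq, multinomial_eq_sum_sub_single k (by omega)]
    exact h2.trans (Finset.sum_le_sum fun i _ => (hstep i).2)

end Factorization

/-! ### Elementary symmetric functions from power sums -/

section Newton

variable {B : Type*} [Ring B] [Algebra ℂ B]

/-- The sequence `η` with `η 0 = 1` and `c η c = - ∑_{s ≥ 1} h s η (c - s)`. When `h s` is the
`s`-th power sum of some elements, `(-1)^c η c` is their elementary symmetric function. -/
noncomputable def newtonSeq (h : ℕ → B) : ℕ → B
  | 0 => 1
  | c + 1 => -(((c : ℂ) + 1)⁻¹ • ∑ s : Fin (c + 1), h (s + 1) * newtonSeq h (c - s))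

@[simp] theorem newtonSeq_zero (h : ℕ → B) : newtonSeq h 0 = 1 := by
  rw [newtonSeq]

theorem newtonSeq_succ (h : ℕ → B) (c : ℕ) :
    ((c : ℂ) + 1) • newtonSeq h (c + 1) =
      -∑ s ∈ Finset.range (c + 1), h (s + 1) * newtonSeq h (c - s) := by
  rw [newtonSeq, smul_neg, smul_smul, mul_inv_cancel₀ (Nat.cast_add_one_ne_zero c), one_smul,
    ← Fin.sum_univ_eq_sum_range (fun s => h (s + 1) * newtonSeq h (c - s))]

theorem eq_of_succ_smul_eq (M : Type*) [AddCommGroup M] [Module ℂ M] (c : ℕ) {x y : M}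
    (h : ((c : ℂ) + 1) • x = ((c : ℂ) + 1) • y) : x = y :=
  smul_right_injective M (Nat.cast_add_one_ne_zero (R := ℂ) c) h

theorem map_newtonSeq {B' : Type*} [Ring B'] [Algebra ℂ B'] (f : B →ₐ[ℂ] B') (h : ℕ → B)
    (c : ℕ) : f (newtonSeq h c) = newtonSeq (fun s => f (h s)) c := by
  induction c using Nat.strong_induction_on with
  | _ c ih =>
    rcases c with - | c
    · simp
    · apply eq_of_succ_smul_eq _ c
      rw [← map_smul, newtonSeq_succ, newtonSeq_succ, map_neg, map_sum]
      congr 1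
      refine Finset.sum_congr rfl fun s hs => ?_
      rw [map_mul, ih _ (by omega)]

theorem commute_newtonSeq {h : ℕ → B} {x : B} (hx : ∀ s, Commute x (h s)) (c : ℕ) :
    Commute x (newtonSeq h c) := by
  induction c using Nat.strong_induction_on with
  | _ c ih =>
    rcases c with - | c
    · simp
    · rw [newtonSeq]
      refine (Commute.smul_right (Commute.sum_right _ _ _ fun s _ => ?_) _).neg_right
      exact (hx _).mul_right (ih _ (by omega))

/-- Newton's recursion can be solved for `h (s + 1)`, whose coefficient is `η 0 = 1`. It says
nothing about `h 0`. -/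
theorem mem_of_newtonSeq_mem (S : Subalgebra ℂ B) {h : ℕ → B} (hS : ∀ c, newtonSeq h c ∈ S)
    (s : ℕ) : h (s + 1) ∈ S := by
  induction s using Nat.strong_induction_on with
  | _ s ih =>
    have h1 := newtonSeq_succ h s
    rw [Finset.sum_range_succ, Nat.sub_self, newtonSeq_zero, mul_one] at h1
    have h2 : h (s + 1) = -(((s : ℂ) + 1) • newtonSeq h (s + 1)) -
        ∑ x ∈ Finset.range s, h (x + 1) * newtonSeq h (s - x) := by
      rw [h1]; abel
    rw [h2]
    refine S.sub_mem (S.neg_mem (S.smul_mem (hS _) _)) (S.sum_mem fun x hx => ?_)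
    exact S.mul_mem (ih x (Finset.mem_range.1 hx)) (hS _)

/-- If `F b` are elements with `[h s, F b] = F (s + b)`, then
`η c * F b = F b * η c - F (b + 1) * η (c - 1)`. -/
theorem newtonSeq_succ_mul {h F : ℕ → B} (hF : ∀ s b, h s * F b = F b * h s + F (s + b))
    (c b : ℕ) :
    newtonSeq h (c + 1) * F b = F b * newtonSeq h (c + 1) - F (b + 1) * newtonSeq h c := by
  induction c using Nat.strong_induction_on generalizing b with
  | _ c ih =>
    apply eq_of_succ_smul_eq _ c
    rw [smul_sub, ← smul_mul_assoc, ← mul_smul_comm, newtonSeq_succ]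
    -- Expanding by the induction hypothesis and moving `h (s + 1)` past `F` leaves commutator terms
    -- arranged so that they telescope over `s`.
    have hterm : ∀ s ∈ Finset.range c, h (s + 1) * newtonSeq h (c - s) * F b =
        F b * (h (s + 1) * newtonSeq h (c - s)) -
          F (b + 1) * (h (s + 1) * newtonSeq h (c - 1 - s)) +
          (F (b + s + 1) * newtonSeq h (c - s) - F (b + (s + 1) + 1) * newtonSeq h (c - (s + 1)))
        := by
      intro s hs
      obtain ⟨d, rfl⟩ : ∃ d, c = s + 1 + d := ⟨c - (s + 1), by
        have := Finset.mem_range.1 hs; omega⟩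
      have e1 : s + 1 + d - s = d + 1 := by omega
      have e2 : s + 1 + d - 1 - s = d := by omega
      have e3 : s + 1 + d - (s + 1) = d := by omega
      rw [e1, e2, e3, mul_assoc, ih d (by omega), mul_sub, ← mul_assoc, ← mul_assoc, hF, hF,
        show s + 1 + b = b + s + 1 by omega, show s + 1 + (b + 1) = b + (s + 1) + 1 by omega]
      noncomm_ring
    rw [Finset.sum_range_succ, neg_mul, add_mul, Finset.sum_mul,
      Finset.sum_congr rfl hterm, Finset.sum_add_distrib,
      Finset.sum_range_sub' (fun s => F (b + s + 1) * newtonSeq h (c - s)),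
      Finset.sum_sub_distrib, ← Finset.mul_sum, ← Finset.mul_sum]
    simp only [Nat.sub_self, newtonSeq_zero, mul_one, Nat.sub_zero, add_zero]
    rw [hF, show c + 1 + b = b + c + 1 by omega]
    -- The factor `c + 1` in front of `F (b + 1) * η c` splits: the part `c` is Newton's recursion
    -- one degree lower, the part 1 is what the telescoping sum leaves.
    have hc : F (b + 1) * ((c : ℂ) • newtonSeq h c) =
        -(F (b + 1) * ∑ s ∈ Finset.range c, h (s + 1) * newtonSeq h (c - 1 - s)) := by
      rcases c with - | c
      · simp
      · push_cast
        rw [newtonSeq_succ, mul_neg]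
    rw [add_smul, one_smul, ← mul_smul_comm, hc]
    noncomm_ring

theorem newtonSeq_eq_zero {h : ℕ → B} (hh : ∀ s, h (s + 1) = 0) (c : ℕ) :
    newtonSeq h (c + 1) = 0 := by
  rw [newtonSeq]; simp [hh]

end Newton

/-- If the power sums of all the families together vanish, the generating series of the
elementary symmetric functions multiply to `1`. -/
theorem prod_mk_newtonSeq_eq_one {ι : Type*} (t : Finset ι) {B : Type*} [CommRing B] [Algebra ℂ B]
    (h : ι → ℕ → B) (hsum : ∀ s, ∑ i ∈ t, h i (s + 1) = 0) :
    ∏ i ∈ t, PowerSeries.mk (newtonSeq (h i)) = 1 := by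
  -- The recursion is the differential equation saying that the logarithmic derivative of the `i`-th
  -- series is `-∑ h i (s + 1) z^s`. Logarithmic derivatives add, so the product has derivative zero
  -- and equals its constant term 1.
  have hd : ∀ i, PowerSeries.derivative B (PowerSeries.mk (newtonSeq (h i))) =
      -(PowerSeries.mk fun s => h i (s + 1)) * PowerSeries.mk (newtonSeq (h i)) := by
    intro i
    ext c
    rw [PowerSeries.coeff_derivative, neg_mul, map_neg, PowerSeries.coeff_mul,
      Finset.Nat.sum_antidiagonal_eq_sum_range_succ_mk]
    simp only [PowerSeries.coeff_mk]
    rw [← newtonSeq_succ, Algebra.smul_def, mul_comm]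
    simp
  have hprod : ∀ u : Finset ι,
      PowerSeries.derivative B (∏ i ∈ u, PowerSeries.mk (newtonSeq (h i))) =
        -(∑ i ∈ u, PowerSeries.mk fun s => h i (s + 1)) *
          ∏ i ∈ u, PowerSeries.mk (newtonSeq (h i)) := by
    classical
    intro u
    induction u using Finset.induction_on with
    | empty => simp
    | insert a u ha ih =>
      rw [Finset.prod_insert ha, Finset.sum_insert ha, Derivation.leibniz, ih, hd]
      simp only [smul_eq_mul]
      ring
  have hz : ∑ i ∈ t, (PowerSeries.mk fun s => h i (s + 1)) = 0 := by
    ext s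
    rw [map_sum]
    simpa using hsum s
  have hp := hprod t
  rw [hz, neg_zero, zero_mul] at hp
  ext c
  rcases c with - | c
  · simp [map_prod]
  · have h1 := congrArg (PowerSeries.coeff c) hp
    rw [PowerSeries.coeff_derivative, map_zero] at h1
    apply eq_of_succ_smul_eq _ c
    rw [PowerSeries.coeff_one, if_neg (Nat.succ_ne_zero c), smul_zero, Algebra.smul_def, mul_comm]
    simpa using h1

/-! ### Representations of the current algebra by operators -/

/-- Write `u ∈ V i` as an element of `T i` plus a sum from the other `T j`. The second summand lies
in `V i` and in the span of the other `V j`, hence is 0. This yields properties of whole eigenspaces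
once vectors having them are known to span. -/
theorem eq_of_le_of_iSupIndep {κ R M : Type*} [Ring R] [AddCommGroup M] [Module R M]
    {V T : κ → Submodule R M} (hV : iSupIndep V) (hTV : ∀ i, T i ≤ V i) (hT : ⨆ i, T i = ⊤) (i : κ) :
    T i = V i := by
  refine le_antisymm (hTV i) fun u hu => ?_
  have hu' : u ∈ T i ⊔ ⨆ (j : κ) (_ : j ≠ i), T j := by
    rw [← iSup_split_single, hT]; trivial
  obtain ⟨a, ha, b, hb, rfl⟩ := Submodule.mem_sup.1 hu'
  have hb1 : b ∈ V i := by
    have := (V i).sub_mem hu (hTV i ha)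
    rwa [add_sub_cancel_left] at this
  have hb2 : b ∈ ⨆ (j : κ) (_ : j ≠ i), V j := iSup₂_mono (fun j _ => hTV j) hb
  have hb0 : b = 0 := (Submodule.disjoint_def.1 (hV i)) b hb1 hb2
  rwa [hb0, add_zero]

section Operators

variable {B : Type*} [Ring B]

theorem mul_pow_succ_of_commute {X f Y : B} (h : X * f = f * X + Y) (hY : Commute Y f) (m : ℕ) :
    X * f ^ (m + 1) = f ^ (m + 1) * X + (m + 1) • (f ^ m * Y) := by
  induction m with
  | zero => simpa using h
  | succ m ih =>
    rw [pow_succ, ← mul_assoc, ih, add_mul, mul_assoc, h, smul_mul_assoc, mul_assoc _ Y f, hY.eq,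
      ← mul_assoc _ f Y, ← pow_succ, mul_add, ← mul_assoc, add_assoc, add_comm (f ^ (m + 1) * Y),
      ← succ_nsmul]

end Operators

section CurrentRep

variable {ι : Type*} [DecidableEq ι] {M : Type*} [AddCommGroup M] [Module ℂ M]

/-- The operators `E a b p` satisfy the relations of the elements `x ^ p ⊗ e_{ab}` of
`𝔤𝔩 ⊗ ℂ[x]`. -/
def IsCurrentRep (E : ι → ι → ℕ → Module.End ℂ M) : Prop :=
  ∀ a b c d p q, E a b p * E c d q = E c d q * E a b p +
    (if b = c then E a d (p + q) else 0) - (if d = a then E c b (p + q) else 0)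

/-- `v` has weight `n ε_j` and is killed by all `x ^ p ⊗ e_{ab}` with `b ≠ j`. -/
structure IsExtremal (E : ι → ι → ℕ → Module.End ℂ M) (j : ι) (n : ℕ) (v : M) : Prop where
  apply_eq_zero : ∀ a b p, b ≠ j → E a b p v = 0
  apply_zero : E j j 0 v = (n : ℂ) • v
  apply_succ : ∀ p, E j j (p + 1) v = 0

/-- `v` generates the module on which the operators `E a b p` act. -/
def Generates (E : ι → ι → ℕ → Module.End ℂ M) (v : M) : Prop :=
  ∀ S : Submodule ℂ M, v ∈ S → (∀ a b p, ∀ u ∈ S, E a b p u ∈ S) → S = ⊤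

variable {E : ι → ι → ℕ → Module.End ℂ M} {j o : ι} {n : ℕ} {v : M}

theorem IsCurrentRep.commute_of_ne (hE : IsCurrentRep E) {a b c d : ι} (hbc : b ≠ c) (hda : d ≠ a)
    (p q : ℕ) : Commute (E a b p) (E c d q) := by
  have := hE a b c d p q
  rwa [if_neg hbc, if_neg hda, add_zero, sub_zero] at this

theorem IsCurrentRep.apply_apply (hE : IsCurrentRep E) (a b c d : ι) (p q : ℕ) (u : M) :
    E a b p (E c d q u) = E c d q (E a b p u) +
      (if b = c then E a d (p + q) u else 0) - (if d = a then E c b (p + q) u else 0) := by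
  have := LinearMap.congr_fun (hE a b c d p q) u
  simp only [LinearMap.sub_apply, LinearMap.add_apply, Module.End.mul_apply] at this
  rw [this]
  split_ifs <;> simp

theorem IsCurrentRep.diag_commute (hE : IsCurrentRep E) (a b : ι) (p q : ℕ) :
    Commute (E a a p) (E b b q) := by
  have := hE a a b b p q
  by_cases h : a = b
  · subst h
    rw [if_pos rfl, add_sub_cancel_right] at this
    exact this
  · exact hE.commute_of_ne h (Ne.symm h) p q

theorem IsCurrentRep.diag_mul_lower (hE : IsCurrentRep E) {i j : ι} (hij : i ≠ j) (s b : ℕ) :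
    E i i s * E i j b = E i j b * E i i s + E i j (s + b) := by
  rw [hE i i i j s b, if_pos rfl, if_neg hij.symm, sub_zero]

/-- A subspace that contains an extremal generator and is closed under lowering operators is
everything. -/
theorem IsExtremal.eq_top (hE : IsCurrentRep E) (hv : IsExtremal E j n v) (hg : Generates E v)
    (S : Submodule ℂ M) (hS : v ∈ S) (hlow : ∀ a p, a ≠ j → ∀ u ∈ S, E a j p u ∈ S) : S = ⊤ := by
  -- The smallest subspace that contains `v` and is closed under lowering turns out to be closed
  -- under all operators, which replaces an appeal to the Poincaré–Birkhoff–Witt theorem.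
  let C : Set (Submodule ℂ M) := {S | v ∈ S ∧ ∀ a p, a ≠ j → ∀ u ∈ S, E a j p u ∈ S}
  have hC : sInf C ∈ C := by
    refine ⟨Submodule.mem_sInf.2 fun T hT => hT.1, fun a p ha u hu => ?_⟩
    exact Submodule.mem_sInf.2 fun T hT => hT.2 a p ha u (Submodule.mem_sInf.1 hu T hT)
  -- The vectors of `sInf C` that all operators keep inside `sInf C`. Commutators of the `E a b p`
  -- are again such operators, so `T` is closed under lowering, and minimality gives `sInf C ≤ T`.
  let T : Submodule ℂ M := sInf C ⊓ ⨅ (a) (b) (p), (sInf C).comap (E a b p)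
  have hT : ∀ u, u ∈ T ↔ u ∈ sInf C ∧ ∀ a b p, E a b p u ∈ sInf C := by
    intro u
    simp [T, Submodule.mem_iInf, Submodule.mem_inf]
  have hTC : T ∈ C := by
    refine ⟨(hT v).2 ⟨hC.1, fun a b p => ?_⟩, fun c q hc u hu => ?_⟩
    · by_cases hb : b = j
      · subst hb
        by_cases ha : a = b
        · subst ha
          rcases p with - | p
          · rw [hv.apply_zero]; exact Submodule.smul_mem _ _ hC.1
          · rw [hv.apply_succ]; exact Submodule.zero_mem _
        · exact hC.2 a p ha v hC.1
      · rw [hv.apply_eq_zero a b p hb]; exact Submodule.zero_mem _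
    · rw [hT] at hu ⊢
      refine ⟨hu.2 _ _ _, fun a b p => ?_⟩
      rw [hE.apply_apply]
      refine Submodule.sub_mem _ (Submodule.add_mem _ (hC.2 _ _ hc _ (hu.2 _ _ _)) ?_) ?_
      · split_ifs
        · exact hu.2 _ _ _
        · exact Submodule.zero_mem _
      · split_ifs
        · exact hu.2 _ _ _
        · exact Submodule.zero_mem _
  have htop : sInf C = ⊤ :=
    hg _ hC.1 fun a b p u hu => ((hT u).1 ((sInf_le hTC : sInf C ≤ T) hu)).2 a b p
  rw [eq_top_iff, ← htop]
  exact sInf_le ⟨hS, hlow⟩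

/-- On the part of `e_{ii}`-weight `κ`, the elementary symmetric functions of degree `> κ` formed
from the operators `x ^ s ⊗ e_{ii}` vanish. -/
theorem IsExtremal.newtonSeq_apply_eq_zero (hE : IsCurrentRep E) (hv : IsExtremal E j n v)
    (hg : Generates E v) {i : ι} (hij : i ≠ j) {κ c : ℕ} {u : M} (hu : E i i 0 u = (κ : ℂ) • u)
    (hc : κ < c) : newtonSeq (E i i) c u = 0 := by
  let V : ℕ → Submodule ℂ M := fun κ => (E i i 0).eigenspace (κ : ℂ)
  -- The eigenvectors for which the claim holds. They span `M`, since `v` lies in `T 0` and lowering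
  -- preserves their span; independence of the eigenspaces then gives `T κ = V κ`.
  let T : ℕ → Submodule ℂ M := fun κ =>
    V κ ⊓ ⨅ (c) (_ : κ < c), LinearMap.ker (newtonSeq (E i i) c)
  have hT : ∀ κ u, u ∈ T κ ↔ E i i 0 u = (κ : ℂ) • u ∧ ∀ c, κ < c → newtonSeq (E i i) c u = 0 := by
    intro κ u
    simp [T, V, Submodule.mem_iInf, Submodule.mem_inf]
  have hV : iSupIndep V := (E i i 0).eigenspaces_iSupIndep.comp Nat.cast_injective
  have htop : ⨆ κ, T κ = ⊤ := by
    refine hv.eq_top hE hg _ (Submodule.mem_iSup_of_mem 0 ((hT 0 v).2 ⟨?_, ?_⟩)) ?_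
    · rw [hv.apply_eq_zero _ _ _ hij]; simp
    · intro c hc
      obtain ⟨c, rfl⟩ := Nat.exists_eq_succ_of_ne_zero hc.ne'
      apply eq_of_succ_smul_eq _ c
      rw [← LinearMap.smul_apply, Nat.succ_eq_add_one, newtonSeq_succ, smul_zero,
        LinearMap.neg_apply, LinearMap.sum_apply, neg_eq_zero]
      refine Finset.sum_eq_zero fun s _ => ?_
      rw [(commute_newtonSeq (fun t => hE.diag_commute i i (s + 1) t) (c - s)).eq,
        Module.End.mul_apply, hv.apply_eq_zero _ _ _ hij, map_zero]
    · intro a p ha u hu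
      induction hu using Submodule.iSup_induction' with
      | zero => rw [map_zero]; exact Submodule.zero_mem _
      | add x y _ _ hx hy => rw [map_add]; exact Submodule.add_mem _ hx hy
      | mem κ u hu =>
        rw [hT] at hu
        by_cases hai : a = i
        · subst hai
          refine Submodule.mem_iSup_of_mem (κ + 1) ((hT _ _).2 ⟨?_, fun c hc => ?_⟩)
          · rw [← Module.End.mul_apply, hE.diag_mul_lower ha, LinearMap.add_apply,
              Module.End.mul_apply, hu.1, zero_add, map_smul]
            push_cast
            module
          -- Lowering by `E i j` raises the weight to `κ + 1`. Moving `η (c + 1)` past it produces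
          -- `η (c + 1)` and `η c`, whose degrees both still exceed `κ`.
          · obtain ⟨c, rfl⟩ := Nat.exists_eq_succ_of_ne_zero (Nat.ne_zero_of_lt hc)
            rw [← Module.End.mul_apply, Nat.succ_eq_add_one,
              newtonSeq_succ_mul (F := E a j) (fun s b => hE.diag_mul_lower ha s b),
              LinearMap.sub_apply, Module.End.mul_apply, Module.End.mul_apply,
              hu.2 _ (by omega), hu.2 _ (by omega), map_zero, map_zero, sub_zero]
        · have hcomm : ∀ s, Commute (E a j p) (E i i s) := fun s =>
            (hE.commute_of_ne (Ne.symm hai) hij.symm s p).symm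
          refine Submodule.mem_iSup_of_mem κ ((hT _ _).2 ⟨?_, fun c hc => ?_⟩)
          · rw [← Module.End.mul_apply, ← (hcomm 0).eq, Module.End.mul_apply, hu.1, map_smul]
          · rw [← Module.End.mul_apply, ← (commute_newtonSeq hcomm c).eq, Module.End.mul_apply,
              hu.2 c hc, map_zero]
  have h1 : T κ = V κ := eq_of_le_of_iSupIndep hV (fun κ => inf_le_left) htop κ
  have h2 : u ∈ T κ := by
    rw [h1]
    exact Module.End.mem_eigenspace_iff.2 hu
  exact ((hT κ u).1 h2).2 c hc

theorem apply_pow_succ_of_commute {X f Y : Module.End ℂ M} {u : M} (h : X * f = f * X + Y)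
    (hY : Commute Y f) (hu : X u = 0) (m : ℕ) :
    X ((f ^ (m + 1)) u) = ((m : ℂ) + 1) • (f ^ m) (Y u) := by
  rw [← Module.End.mul_apply, mul_pow_succ_of_commute h hY, LinearMap.add_apply,
    Module.End.mul_apply, hu, map_zero, zero_add, LinearMap.smul_apply, Module.End.mul_apply,
    ← Nat.cast_smul_eq_nsmul ℂ]
  push_cast
  rfl

theorem apply_pow_of_commute {X f Y : Module.End ℂ M} {u : M} (h : X * f = f * X + Y)
    (hY : Commute Y f) (hu : X u = 0) (hYu : Y u = 0) (m : ℕ) : X ((f ^ m) u) = 0 := by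
  rcases m with - | m
  · simpa using hu
  · rw [apply_pow_succ_of_commute h hY hu, hYu, map_zero, smul_zero]

/-! ### Reflection of an extremal vector through the `sl₂` of a pair of indices. -/

section Reflection

variable (hE : IsCurrentRep E) (hv : IsExtremal E o n v) (hjo : j ≠ o)
include hE hjo

theorem IsCurrentRep.source_mul_lower (s b : ℕ) :
    E o o s * E j o b = E j o b * E o o s + -E j o (s + b) := by
  rw [hE o o j o s b, if_pos rfl, if_neg hjo.symm, add_zero, sub_eq_add_neg]

theorem IsCurrentRep.commute_lower (i : ι) (hio : i ≠ o) (s b : ℕ) :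
    Commute (E i o s) (E j o b) :=
  hE.commute_of_ne hjo.symm hio.symm s b

omit hjo in
theorem IsCurrentRep.raise_apply_lower (p : ℕ) (u : M) :
    E o j p (E j o 0 u) = E j o 0 (E o j p u) + E o o p u - E j j p u := by
  rw [hE.apply_apply, if_pos rfl, if_pos rfl, add_zero]

include hv

theorem IsExtremal.source_apply_pow (m : ℕ) :
    E o o 0 ((E j o 0 ^ m) v) = ((n : ℂ) - m) • (E j o 0 ^ m) v := by
  induction m with
  | zero => simpa using hv.apply_zero
  | succ m ih =>
    rw [pow_succ', Module.End.mul_apply, ← Module.End.mul_apply, hE.source_mul_lower hjo,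
      LinearMap.add_apply, Module.End.mul_apply, ih, map_smul, LinearMap.neg_apply]
    push_cast
    module

theorem IsExtremal.target_apply_pow (m : ℕ) :
    E j j 0 ((E j o 0 ^ m) v) = (m : ℂ) • (E j o 0 ^ m) v := by
  induction m with
  | zero => simpa using hv.apply_eq_zero j j 0 hjo
  | succ m ih =>
    rw [pow_succ', Module.End.mul_apply, ← Module.End.mul_apply, hE.diag_mul_lower hjo,
      LinearMap.add_apply, Module.End.mul_apply, ih, map_smul]
    push_cast
    module

theorem IsExtremal.raise_apply_pow (m : ℕ) :
    E o j 0 ((E j o 0 ^ (m + 1)) v) = (((m : ℂ) + 1) * (n - m)) • (E j o 0 ^ m) v := by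
  induction m with
  | zero =>
    rw [pow_succ', Module.End.mul_apply, hE.raise_apply_lower, pow_zero,
      Module.End.one_apply, hv.apply_eq_zero _ _ _ hjo, hv.apply_eq_zero _ _ _ hjo, hv.apply_zero]
    simp
  | succ m ih =>
    rw [pow_succ', Module.End.mul_apply, hE.raise_apply_lower, ih,
      hv.source_apply_pow hE hjo, hv.target_apply_pow hE hjo, map_smul, pow_succ' _ m,
      Module.End.mul_apply]
    push_cast
    module

theorem IsExtremal.source_succ_apply_pow (p m : ℕ) :
    E o o (p + 1) ((E j o 0 ^ (m + 1)) v) =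
      -(((m : ℂ) + 1) • (E j o 0 ^ m) (E j o (p + 1) v)) := by
  rw [apply_pow_succ_of_commute (hE.source_mul_lower hjo (p + 1) 0)
    ((hE.commute_lower hjo j hjo _ _).neg_left) (hv.apply_succ p)]
  simp

theorem IsExtremal.target_succ_apply_pow (p m : ℕ) :
    E j j (p + 1) ((E j o 0 ^ (m + 1)) v) =
      ((m : ℂ) + 1) • (E j o 0 ^ m) (E j o (p + 1) v) := by
  rw [apply_pow_succ_of_commute (hE.diag_mul_lower hjo (p + 1) 0)
    (hE.commute_lower hjo j hjo _ _) (hv.apply_eq_zero _ _ _ hjo), add_zero]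

/-- With `m + 2 = n + 1` and `f ^ (n + 1) v = 0`, for `f = e_{jo}`, this gives `f ^ (n - 1) (x^{p+1}
f) v = 0`, the relation on which the reflection rests. -/
theorem IsExtremal.raise_succ_apply_pow (p m : ℕ) :
    E o j (p + 1) ((E j o 0 ^ (m + 2)) v) =
      -((((m : ℂ) + 2) * (m + 1)) • (E j o 0 ^ m) (E j o (p + 1) v)) := by
  induction m with
  | zero =>
    rw [pow_succ', Module.End.mul_apply, hE.raise_apply_lower,
      hv.source_succ_apply_pow hE hjo, hv.target_succ_apply_pow hE hjo, pow_one,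
      hE.raise_apply_lower, hv.apply_eq_zero _ _ _ hjo, hv.apply_eq_zero _ _ _ hjo,
      hv.apply_succ]
    simp only [map_zero, pow_zero, Module.End.one_apply, Nat.cast_zero, add_zero, sub_zero]
    module
  | succ m ih =>
    rw [pow_succ', Module.End.mul_apply, hE.raise_apply_lower, ih,
      hv.source_succ_apply_pow hE hjo, hv.target_succ_apply_pow hE hjo, map_neg, map_smul,
      pow_succ' _ m, Module.End.mul_apply]
    push_cast
    module

variable (hpow : (E j o 0 ^ (n + 1)) v = 0)
include hpow

/-- Weyl group reflection: `f ^ n v` is extremal of weight `n ε_j`. -/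
theorem IsExtremal.reflect : IsExtremal E j n ((E j o 0 ^ n) v) := by
  have hlast : ∀ m p, n = m + 1 → (E j o 0 ^ m) (E j o (p + 1) v) = 0 := by
    rintro m p rfl
    have h1 := hv.raise_succ_apply_pow hE hjo p m
    rw [hpow, map_zero, eq_comm, neg_eq_zero, smul_eq_zero] at h1
    refine h1.resolve_left ?_
    norm_cast
  refine ⟨fun a b p hb => ?_, ?_, fun p => ?_⟩
  · by_cases hbo : b = o
    · subst hbo
      by_cases ha : a = b
      · subst ha
        rcases p with - | p
        · rw [hv.source_apply_pow hE hjo, sub_self, zero_smul]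
        · rcases n with - | n
          · simpa using hv.apply_succ p
          · rw [hv.source_succ_apply_pow hE hjo, hlast _ _ rfl, smul_zero, neg_zero]
      -- Here `[x^p e_{aj}, f] = x^p e_{ao}`. Applying `x^p e_{aj}` to `f ^ (n + 1) v = 0` gives `(n
      -- + 1) f ^ n (x^p e_{ao}) v = 0`.
      · have h1 : E a j p * E j b 0 = E j b 0 * E a j p + E a b p := by
          rw [hE, if_pos rfl, if_neg (Ne.symm ha), sub_zero, add_zero]
        have h2 := apply_pow_succ_of_commute h1 (hE.commute_lower hjo a ha p 0)
          (hv.apply_eq_zero a j p hjo) n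
        rw [hpow, map_zero, eq_comm, smul_eq_zero] at h2
        rw [← Module.End.mul_apply, ((hE.commute_lower hjo a ha p 0).pow_right n).eq]
        exact h2.resolve_left (Nat.cast_add_one_ne_zero n)
    · by_cases ha : a = o
      · subst ha
        refine apply_pow_of_commute (Y := -E j b p) ?_ ?_ (hv.apply_eq_zero _ _ _ hbo) ?_ n
        · rw [hE, if_neg hb, if_pos rfl, add_zero, add_zero, sub_eq_add_neg]
        · exact (hE.commute_of_ne hb hjo.symm p 0).neg_left
        · rw [LinearMap.neg_apply, hv.apply_eq_zero _ _ _ hbo, neg_zero]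
      · rw [← Module.End.mul_apply, ((hE.commute_of_ne hb (Ne.symm ha) p 0).pow_right n).eq,
          Module.End.mul_apply, hv.apply_eq_zero _ _ _ hbo, map_zero]
  · exact hv.target_apply_pow hE hjo n
  · rcases n with - | n
    · simpa using hv.apply_eq_zero j j _ hjo
    · rw [hv.target_succ_apply_pow hE hjo, hlast _ _ rfl, smul_zero]

omit hpow in
-- Raising `n` times returns from `f ^ n v` to a nonzero multiple of `v`: each step has the factor
-- `(d + 1) (n - d)` with `d < n`.
theorem IsExtremal.reflect_generates (hg : Generates E v) :
    Generates E ((E j o 0 ^ n) v) := by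
  intro S hS hcl
  refine hg S ?_ hcl
  have h : ∀ m ≤ n, (E j o 0 ^ (n - m)) v ∈ S := by
    intro m
    induction m with
    | zero => exact fun _ => hS
    | succ m ih =>
      intro hm
      have h1 := hcl o j 0 _ (ih (by omega))
      obtain ⟨d, hd⟩ : ∃ d, n - m = d + 1 := ⟨n - (m + 1), by omega⟩
      rw [hd, hv.raise_apply_pow hE hjo] at h1
      rw [show n - (m + 1) = d by omega]
      have hne : ((d : ℂ) + 1) * (n - d) ≠ 0 := by
        refine mul_ne_zero (Nat.cast_add_one_ne_zero d) (sub_ne_zero.2 ?_)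
        exact_mod_cast (by omega : n ≠ d)
      exact (S.smul_mem_iff hne).1 h1
  simpa using h n le_rfl

end Reflection

end CurrentRep

/-! ### Spanning vectors of the weight parts and the upper bound for their dimensions. -/

section UpperBound

variable {ι : Type*} [Fintype ι] [DecidableEq ι] {M : Type*} [AddCommGroup M] [Module ℂ M]
  {E : ι → ι → ℕ → Module.End ℂ M} {o : ι} {n : ℕ} {v : M}

/-- The lowering operators `1 ⊗ e_{io}`, `i ≠ o`. -/
def lower (E : ι → ι → ℕ → Module.End ℂ M) (o i : ι) : Module.End ℂ M :=
  if i = o then 1 else E i o 0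

omit [Fintype ι] in
theorem lower_of_ne {i : ι} (hi : i ≠ o) : lower E o i = E i o 0 := if_neg hi

omit [Fintype ι] in
theorem IsCurrentRep.commute_lower_operator (hE : IsCurrentRep E) {i : ι} (hi : i ≠ o) (s : ℕ)
    (l : ι) : Commute (E i o s) (lower E o l) := by
  unfold lower
  split_ifs with h
  · exact Commute.one_right _
  · exact hE.commute_of_ne (Ne.symm h) hi.symm s 0

omit [Fintype ι] in
theorem IsCurrentRep.lower_commute (hE : IsCurrentRep E) (i l : ι) :
    Commute (lower E o i) (lower E o l) := by
  by_cases h : i = o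
  · rw [lower, if_pos h]
    exact Commute.one_left _
  · rw [lower_of_ne h]
    exact hE.commute_lower_operator h 0 l

omit [Fintype ι] in
theorem IsCurrentRep.pairwise_commute_lower (hE : IsCurrentRep E) (o : ι) :
    Pairwise fun i l => ∀ x y : Multiplicative ℕ,
      Commute (powersHom _ (lower E o i) x) (powersHom _ (lower E o l) y) :=
  fun i l _ x y => by simpa using (hE.lower_commute i l).pow_pow _ _

/-- The monomials `∏_{i ≠ o} (1 ⊗ e_{io}) ^ (k i)` in the lowering operators. -/
noncomputable def lowerMonomial (hE : IsCurrentRep E) (o : ι) :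
    (∀ _ : ι, Multiplicative ℕ) →* Module.End ℂ M :=
  MonoidHom.noncommPiCoprod (fun i => powersHom _ (lower E o i)) (hE.pairwise_commute_lower o)

theorem lowerMonomial_eq_noncommProd (hE : IsCurrentRep E) (k : ι → ℕ) :
    lowerMonomial hE o (fun i => Multiplicative.ofAdd (k i)) =
      Finset.univ.noncommProd (fun i => lower E o i ^ k i)
        (fun i _ l _ _ => (hE.lower_commute i l).pow_pow _ _) := rfl

/-- The vectors `∏_{i ≠ o} (1 ⊗ e_{io}) ^ (k i) v`. -/
noncomputable def lowerVector (hE : IsCurrentRep E) (o : ι) (v : M) (k : ι → ℕ) : M :=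
  lowerMonomial hE o (fun i => Multiplicative.ofAdd (k i)) v

theorem lowerMonomial_add (hE : IsCurrentRep E) (k l : ι → ℕ) :
    lowerMonomial hE o (fun i => Multiplicative.ofAdd ((k + l) i)) =
      lowerMonomial hE o (fun i => Multiplicative.ofAdd (k i)) *
        lowerMonomial hE o (fun i => Multiplicative.ofAdd (l i)) := by
  rw [← map_mul]
  rfl

theorem lowerMonomial_single (hE : IsCurrentRep E) (i : ι) (m : ℕ) :
    lowerMonomial hE o (fun l => Multiplicative.ofAdd ((Pi.single i m : ι → ℕ) l)) =
      lower E o i ^ m := by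
  have : (fun l => Multiplicative.ofAdd ((Pi.single i m : ι → ℕ) l)) =
      Pi.mulSingle i (Multiplicative.ofAdd m) := by
    ext l
    by_cases h : l = i
    · subst h; simp
    · simp [h]
  rw [this, lowerMonomial, MonoidHom.noncommPiCoprod_mulSingle]
  simp

theorem commute_lowerMonomial (hE : IsCurrentRep E) {X : Module.End ℂ M} {k : ι → ℕ}
    (hX : ∀ i, k i ≠ 0 → Commute X (lower E o i)) :
    Commute X (lowerMonomial hE o (fun i => Multiplicative.ofAdd (k i))) := by
  rw [lowerMonomial_eq_noncommProd]
  refine Finset.noncommProd_commute _ _ _ _ fun i _ => ?_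
  by_cases h : k i = 0
  · rw [h, pow_zero]
    exact Commute.one_right _
  · exact (hX i h).pow_right _

/-- The exponent at `o` is a dummy, because `lower E o o = 1`. This freedom is used later to make
the exponents add up to `n`. -/
theorem lowerMonomial_congr (hE : IsCurrentRep E) {k l : ι → ℕ} (h : ∀ i, i ≠ o → k i = l i) :
    lowerMonomial hE o (fun i => Multiplicative.ofAdd (k i)) =
      lowerMonomial hE o (fun i => Multiplicative.ofAdd (l i)) := by
  rw [lowerMonomial_eq_noncommProd, lowerMonomial_eq_noncommProd]
  refine Finset.noncommProd_congr rfl (fun i _ => ?_) _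
  by_cases hi : i = o
  · rw [lower, if_pos hi, one_pow, one_pow]
  · rw [h i hi]

omit [Fintype ι] in
theorem update_zero_add_single (k : ι → ℕ) (i : ι) (m : ℕ) :
    k + Pi.single i m = Function.update k i 0 + Pi.single i (k i + m) := by
  ext l
  by_cases h : l = i
  · subst h; simp
  · simp [h]

/-- How an operator `X` that kills `v` and commutes with all lowering operators but one acts on
the vectors `lowerVector`. -/
theorem apply_lowerVector_add_single (hE : IsCurrentRep E) {X Y : Module.End ℂ M} {i : ι}
    (hXY : X * lower E o i = lower E o i * X + Y) (hX : ∀ l, l ≠ i → Commute X (lower E o l))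
    (hY : ∀ l, Commute Y (lower E o l)) (hv : X v = 0) (k : ι → ℕ) :
    X (lowerVector hE o v (k + Pi.single i 1)) = ((k i : ℂ) + 1) • Y (lowerVector hE o v k) := by
  -- Split off the `i`-th exponent: `X` commutes with the remaining factors and meets only a power
  -- of `lower E o i`.
  have h1 := update_zero_add_single k i 1
  have h2 := update_zero_add_single k i 0
  rw [Pi.single_zero, add_zero, add_zero] at h2
  have hc : Commute X (lowerMonomial hE o
      (fun l => Multiplicative.ofAdd (Function.update k i 0 l))) :=
    commute_lowerMonomial hE fun l hl => hX l (by rintro rfl; simp at hl)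
  have h3 : lowerMonomial hE o (fun l => Multiplicative.ofAdd (k l)) =
      lowerMonomial hE o (fun l => Multiplicative.ofAdd (Function.update k i 0 l)) *
        lower E o i ^ k i := by
    conv_lhs => rw [h2, lowerMonomial_add, lowerMonomial_single]
  unfold lowerVector
  rw [h1, lowerMonomial_add, lowerMonomial_single, ← Module.End.mul_apply, ← mul_assoc, hc.eq,
    Module.End.mul_apply, Module.End.mul_apply, apply_pow_succ_of_commute hXY (hY i) hv,
    map_smul, h3, ← Module.End.mul_apply Y, ← mul_assoc,
    (commute_lowerMonomial hE fun l _ => hY l).eq, mul_assoc, ((hY i).pow_right (k i)).eq,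
    Module.End.mul_apply, Module.End.mul_apply]

theorem lowerVector_add_single (hE : IsCurrentRep E) {i : ι} (hi : i ≠ o) (k : ι → ℕ) :
    lowerVector hE o v (k + Pi.single i 1) = E i o 0 (lowerVector hE o v k) := by
  unfold lowerVector
  rw [add_comm, lowerMonomial_add, lowerMonomial_single, pow_one, lower_of_ne hi,
    Module.End.mul_apply]

/-- Since `[x^s e_{ii}, e_{io}] = x^s e_{io}`, a lowering operator carrying a power of `x` is, up to
a nonzero scalar, a diagonal operator applied to the next monomial vector. -/
theorem IsExtremal.diag_apply_lowerVector (hE : IsCurrentRep E) (hv : IsExtremal E o n v) {i : ι}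
    (hi : i ≠ o) (s : ℕ) (k : ι → ℕ) :
    E i i s (lowerVector hE o v (k + Pi.single i 1)) =
      ((k i : ℂ) + 1) • E i o s (lowerVector hE o v k) := by
  refine apply_lowerVector_add_single hE ?_ (fun l hl => ?_) (hE.commute_lower_operator hi s)
    (hv.apply_eq_zero _ _ _ hi) k
  · rw [lower_of_ne hi, hE.diag_mul_lower hi, add_zero]
  · unfold lower
    split_ifs with h
    · exact Commute.one_right _
    · exact hE.commute_of_ne hl.symm hi.symm s 0

theorem IsExtremal.diag_zero_apply_lowerVector (hE : IsCurrentRep E) (hv : IsExtremal E o n v)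
    {i : ι} (hi : i ≠ o) (k : ι → ℕ) :
    E i i 0 (lowerVector hE o v k) = (k i : ℂ) • lowerVector hE o v k := by
  by_cases hk : k i = 0
  · have hc : Commute (E i i 0) (lowerMonomial hE o (fun i => Multiplicative.ofAdd (k i))) := by
      refine commute_lowerMonomial hE fun l hl => ?_
      unfold lower
      split_ifs with h
      · exact Commute.one_right _
      · exact hE.commute_of_ne (by rintro rfl; exact hl hk) hi.symm 0 0
    rw [hk, Nat.cast_zero, zero_smul, lowerVector, ← Module.End.mul_apply, hc.eq,
      Module.End.mul_apply, hv.apply_eq_zero _ _ _ hi, map_zero]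
  · obtain ⟨k', rfl⟩ : ∃ k', k = k' + Pi.single i 1 := ⟨k - Pi.single i 1, by
      ext l
      by_cases h : l = i
      · subst h; simp; omega
      · simp [h]⟩
    rw [hv.diag_apply_lowerVector hE hi, lowerVector_add_single hE hi]
    simp

theorem IsExtremal.exchange_apply_lowerVector (hE : IsCurrentRep E) (hv : IsExtremal E o n v)
    {i l : ι} (hi : i ≠ o) (hl : l ≠ o) (k : ι → ℕ) :
    E i l 0 (lowerVector hE o v (k + Pi.single l 1)) =
      ((k l : ℂ) + 1) • lowerVector hE o v (k + Pi.single i 1) := by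
  rw [lowerVector_add_single hE hi]
  refine apply_lowerVector_add_single hE ?_ (fun m hm => ?_) (hE.commute_lower_operator hi 0)
    (hv.apply_eq_zero _ _ _ hl) k
  · rw [lower_of_ne hl, hE, if_pos rfl, if_neg hi.symm, sub_zero, add_zero]
  · unfold lower
    split_ifs with h
    · exact Commute.one_right _
    · exact hE.commute_of_ne hm.symm hi.symm 0 0

/-- For a power of a single `e_{lo}` this is `hpow`. Otherwise `e_{il}` maps the vector with one
exponent moved from `i` to `l` to a nonzero multiple of the given one, so induction on the total
exponent at indices other than `o` and `l` applies. -/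
theorem IsExtremal.lowerVector_eq_zero (hE : IsCurrentRep E) (hv : IsExtremal E o n v)
    (hpow : ∀ i, i ≠ o → (E i o 0 ^ (n + 1)) v = 0) (k : ι → ℕ)
    (hk : n < ∑ i ∈ Finset.univ.erase o, k i) : lowerVector hE o v k = 0 := by
  obtain ⟨l, hl, -⟩ := Finset.exists_ne_zero_of_sum_ne_zero (Nat.ne_zero_of_lt hk)
  replace hl := Finset.ne_of_mem_erase hl
  obtain ⟨m, hm⟩ : ∃ m, m = ∑ i ∈ (Finset.univ.erase o).erase l, k i := ⟨_, rfl⟩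
  induction m generalizing k with
  | zero =>
    rw [eq_comm, Finset.sum_eq_zero_iff] at hm
    rw [← Finset.add_sum_erase _ _ (Finset.mem_erase.2 ⟨hl, Finset.mem_univ l⟩),
      Finset.sum_eq_zero hm, add_zero] at hk
    have hkl : lowerMonomial hE o (fun i => Multiplicative.ofAdd (k i)) = lower E o l ^ k l := by
      rw [← lowerMonomial_single hE]
      refine lowerMonomial_congr hE fun i hi => ?_
      by_cases h : i = l
      · subst h; simp
      · rw [hm i (by simp [h, hi])]; simp [h]
    rw [lowerVector, hkl, lower_of_ne hl]
    obtain ⟨d, hd⟩ := Nat.exists_eq_add_of_le (Nat.succ_le_of_lt hk)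
    rw [hd, add_comm, pow_add, Module.End.mul_apply, Nat.succ_eq_add_one, hpow l hl, map_zero]
  | succ m ih =>
    obtain ⟨i, hi, hki⟩ := Finset.exists_ne_zero_of_sum_ne_zero (hm.symm.trans_ne (Nat.succ_ne_zero m))
    have hio : i ≠ o := Finset.ne_of_mem_erase (Finset.mem_of_mem_erase hi)
    have hil : i ≠ l := Finset.ne_of_mem_erase hi
    obtain ⟨k', rfl⟩ : ∃ k', k = k' + Pi.single i 1 := ⟨k - Pi.single i 1, by
      ext l
      by_cases h : l = i
      · subst h; simp; omega
      · simp [h]⟩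
    have h1 := ih (k' + Pi.single l 1) ?_ ?_
    · have h2 := hv.exchange_apply_lowerVector hE hio hl k'
      rw [h1, map_zero, eq_comm, smul_eq_zero] at h2
      exact h2.resolve_left (Nat.cast_add_one_ne_zero _)
    · simp only [Pi.add_apply, Finset.sum_add_distrib] at hk ⊢
      simpa [hl, hio] using hk
    · simp only [Pi.add_apply, Finset.sum_add_distrib] at hm ⊢
      simp [hio, hil] at hm ⊢
      omega

/-- The commutative algebra generated by the operators `x ^ p ⊗ e_{ii}`. -/
def diagAlgebra (E : ι → ι → ℕ → Module.End ℂ M) : Subalgebra ℂ (Module.End ℂ M) :=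
  Algebra.adjoin ℂ (Set.range fun x : ι × ℕ => E x.1 x.1 x.2)

omit [Fintype ι] [DecidableEq ι] in
theorem diag_mem_diagAlgebra (E : ι → ι → ℕ → Module.End ℂ M) (i : ι) (p : ℕ) :
    E i i p ∈ diagAlgebra E :=
  Algebra.subset_adjoin ⟨(i, p), rfl⟩

/-- The subspace generated by the vector `lowerVector k` under the diagonal operators. -/
noncomputable def weightPart (hE : IsCurrentRep E) (o : ι) (v : M) (k : ι → ℕ) : Submodule ℂ M :=
  (Subalgebra.toSubmodule (diagAlgebra E)).map (LinearMap.applyₗ (lowerVector hE o v k))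

theorem mem_weightPart (hE : IsCurrentRep E) {k : ι → ℕ} {u : M} :
    u ∈ weightPart hE o v k ↔ ∃ b ∈ diagAlgebra E, b (lowerVector hE o v k) = u := by
  simp [weightPart, Submodule.mem_map]

theorem lowerVector_mem_weightPart (hE : IsCurrentRep E) (k : ι → ℕ) :
    lowerVector hE o v k ∈ weightPart hE o v k :=
  (mem_weightPart hE).2 ⟨1, one_mem _, rfl⟩

theorem apply_mem_weightPart (hE : IsCurrentRep E) {k : ι → ℕ} {u : M}
    (hu : u ∈ weightPart hE o v k) {b : Module.End ℂ M} (hb : b ∈ diagAlgebra E) :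
    b u ∈ weightPart hE o v k := by
  obtain ⟨c, hc, rfl⟩ := (mem_weightPart hE).1 hu
  exact (mem_weightPart hE).2 ⟨b * c, mul_mem hb hc, rfl⟩

theorem IsExtremal.lower_mem_weightPart (hE : IsCurrentRep E) (hv : IsExtremal E o n v) {i : ι}
    (hi : i ≠ o) {k : ι → ℕ} {u : M} (hu : u ∈ weightPart hE o v k) (s : ℕ) :
    E i o s u ∈ weightPart hE o v (k + Pi.single i 1) := by
  obtain ⟨b, hb, rfl⟩ := (mem_weightPart hE).1 hu
  clear hu
  -- Commuting `x^s e_{io}` past `x^p e_{ll}` produces `x^{s+p} e_{io}`, so all `s` must be treated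
  -- at once; `u` is arbitrary so that products of diagonal operators can be handled.
  have key : ∀ u : M, (∀ s, E i o s u ∈ weightPart hE o v (k + Pi.single i 1)) →
      ∀ s, E i o s (b u) ∈ weightPart hE o v (k + Pi.single i 1) := by
    unfold diagAlgebra at hb
    induction hb using Algebra.adjoin_induction with
    | mem x hx =>
      obtain ⟨⟨l, p⟩, rfl⟩ := hx
      intro u hu s
      change E i o s (E l l p u) ∈ _
      rw [hE.apply_apply]
      refine Submodule.sub_mem _ (Submodule.add_mem _
        (apply_mem_weightPart hE (hu s) (diag_mem_diagAlgebra E l p)) ?_) ?_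
      · split_ifs with h
        · subst h; exact hu _
        · exact Submodule.zero_mem _
      · split_ifs with h
        · subst h; exact hu _
        · exact Submodule.zero_mem _
    | algebraMap c =>
      intro u hu s
      rw [Module.algebraMap_end_apply, map_smul]
      exact Submodule.smul_mem _ _ (hu s)
    | add a b _ _ ha hb =>
      intro u hu s
      rw [LinearMap.add_apply, map_add]
      exact Submodule.add_mem _ (ha u hu s) (hb u hu s)
    | mul a b _ _ ha hb =>
      intro u hu s
      exact ha _ (hb u hu) s
  refine key _ (fun s => ?_) s
  have h1 := hv.diag_apply_lowerVector hE hi s k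
  have h2 := apply_mem_weightPart hE (lowerVector_mem_weightPart (o := o) (v := v) hE (k + Pi.single i 1))
    (diag_mem_diagAlgebra E i s)
  rw [h1] at h2
  exact (Submodule.smul_mem_iff _ (Nat.cast_add_one_ne_zero (k i))).1 h2

theorem IsExtremal.iSup_weightPart (hE : IsCurrentRep E) (hv : IsExtremal E o n v)
    (hg : Generates E v) : ⨆ k, weightPart hE o v k = ⊤ := by
  refine hv.eq_top hE hg _ (Submodule.mem_iSup_of_mem 0 ?_) fun i p hi u hu => ?_
  · have : lowerVector hE o v 0 = v := by
      change lowerMonomial hE o 1 v = v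
      rw [map_one, Module.End.one_apply]
    have h := lowerVector_mem_weightPart (o := o) (v := v) hE 0
    rwa [this] at h
  · induction hu using Submodule.iSup_induction' with
    | zero => rw [map_zero]; exact Submodule.zero_mem _
    | add x y _ _ hx hy => rw [map_add]; exact Submodule.add_mem _ hx hy
    | mem k u hu => exact Submodule.mem_iSup_of_mem _ (hv.lower_mem_weightPart hE hi hu p)

theorem IsExtremal.iSup_weightPart_piAntidiag (hE : IsCurrentRep E) (hv : IsExtremal E o n v)
    (hg : Generates E v) (hpow : ∀ i, i ≠ o → (E i o 0 ^ (n + 1)) v = 0) :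
    ⨆ k ∈ Finset.piAntidiag Finset.univ n, weightPart hE o v k = ⊤ := by
  rw [eq_top_iff, ← hv.iSup_weightPart hE hg]
  refine iSup_le fun k => ?_
  by_cases hk : n < ∑ i ∈ Finset.univ.erase o, k i
  · rw [weightPart, hv.lowerVector_eq_zero hE hpow k hk]
    rintro _ ⟨b, -, rfl⟩
    simp
  -- The dummy exponent at `o` is chosen to bring the total to `n`.
  · let k' := Function.update k o (n - ∑ i ∈ Finset.univ.erase o, k i)
    have hk' : weightPart hE o v k = weightPart hE o v k' := by
      unfold weightPart lowerVector
      rw [lowerMonomial_congr hE (l := k')]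
      intro i hi
      simp [k', hi]
    rw [hk']
    refine le_iSup₂_of_le k' ?_ le_rfl
    rw [Finset.mem_piAntidiag]
    refine ⟨?_, fun i _ => Finset.mem_univ i⟩
    rw [← Finset.add_sum_erase _ _ (Finset.mem_univ o),
      Finset.sum_congr rfl fun i hi =>
        show k' i = k i from Function.update_of_ne (Finset.ne_of_mem_erase hi) _ _]
    rw [Function.update_self]
    exact Nat.sub_add_cancel (not_lt.1 hk)

omit [Fintype ι] [DecidableEq ι] in
-- An eigenspace of an operator that commutes with the action is a submodule; this one contains the
-- generator.
theorem Generates.apply_eq_smul (hg : Generates E v) {Z : Module.End ℂ M} {c : ℂ}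
    (hZ : ∀ a b p, Commute Z (E a b p)) (hv : Z v = c • v) (u : M) : Z u = c • u := by
  have h := hg (Z.eigenspace c) (Module.End.mem_eigenspace_iff.2 hv) fun a b p u hu => by
    rw [Module.End.mem_eigenspace_iff] at hu ⊢
    rw [← Module.End.mul_apply, (hZ a b p).eq, Module.End.mul_apply, hu, map_smul]
  exact Module.End.mem_eigenspace_iff.1 (h ▸ Submodule.mem_top)

theorem IsCurrentRep.commute_sum_diag (hE : IsCurrentRep E) (s : ℕ) (a b : ι) (p : ℕ) :
    Commute (∑ i, E i i s) (E a b p) := by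
  change _ * _ = _ * _
  rw [Finset.sum_mul, Finset.mul_sum, Finset.sum_congr rfl fun i _ => hE i i a b s p,
    Finset.sum_sub_distrib, Finset.sum_add_distrib]
  simp

theorem IsExtremal.sum_diag_zero (hE : IsCurrentRep E) (hv : IsExtremal E o n v)
    (hg : Generates E v) (u : M) : ∑ i, E i i 0 u = (n : ℂ) • u := by
  rw [← LinearMap.sum_apply]
  refine hg.apply_eq_smul (hE.commute_sum_diag 0) ?_ u
  rw [LinearMap.sum_apply, Finset.sum_eq_single o (fun i _ hi => hv.apply_eq_zero _ _ _ hi)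
    (by simp), hv.apply_zero]

theorem IsExtremal.sum_diag_succ (hE : IsCurrentRep E) (hv : IsExtremal E o n v)
    (hg : Generates E v) (s : ℕ) : ∑ i, E i i (s + 1) = 0 := by
  ext u
  rw [hg.apply_eq_smul (c := 0) (hE.commute_sum_diag (s + 1)), zero_smul, LinearMap.zero_apply]
  rw [LinearMap.sum_apply, zero_smul]
  refine Finset.sum_eq_zero fun i _ => ?_
  by_cases hi : i = o
  · rw [hi, hv.apply_succ]
  · exact hv.apply_eq_zero _ _ _ hi

theorem IsExtremal.diag_zero_apply_lowerVector' (hE : IsCurrentRep E) (hv : IsExtremal E o n v)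
    (hg : Generates E v) {k : ι → ℕ} (hk : ∑ i, k i = n) (i : ι) :
    E i i 0 (lowerVector hE o v k) = (k i : ℂ) • lowerVector hE o v k := by
  by_cases hi : i = o
  · subst hi
    have h1 := hv.sum_diag_zero hE hg (lowerVector hE i v k)
    rw [← Finset.add_sum_erase _ _ (Finset.mem_univ i), Finset.sum_congr rfl fun l hl =>
      hv.diag_zero_apply_lowerVector hE (Finset.ne_of_mem_erase hl) k, ← Finset.sum_smul,
      ← eq_sub_iff_add_eq, ← sub_smul] at h1
    rw [h1]
    congr 1
    rw [← hk, ← Finset.add_sum_erase _ _ (Finset.mem_univ i)]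
    push_cast
    ring
  · exact hv.diag_zero_apply_lowerVector hE hi k

omit [Fintype ι] in
theorem IsCurrentRep.commute_of_mem_diagAlgebra (hE : IsCurrentRep E) {b : Module.End ℂ M}
    (hb : b ∈ diagAlgebra E) (i : ι) (p : ℕ) : Commute (E i i p) b := by
  unfold diagAlgebra at hb
  induction hb using Algebra.adjoin_induction with
  | mem x hx =>
    obtain ⟨⟨l, q⟩, rfl⟩ := hx
    exact hE.diag_commute i l p q
  | algebraMap c => exact (Algebra.commutes c _).symm
  | add a b _ _ ha hb => exact ha.add_right hb
  | mul a b _ _ ha hb => exact ha.mul_right hb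

theorem IsExtremal.diag_zero_apply_of_mem (hE : IsCurrentRep E) (hv : IsExtremal E o n v)
    (hg : Generates E v) {k : ι → ℕ} (hk : ∑ i, k i = n) {u : M} (hu : u ∈ weightPart hE o v k)
    (i : ι) : E i i 0 u = (k i : ℂ) • u := by
  obtain ⟨b, hb, rfl⟩ := (mem_weightPart hE).1 hu
  rw [← Module.End.mul_apply, (hE.commute_of_mem_diagAlgebra hb i 0).eq, Module.End.mul_apply,
    hv.diag_zero_apply_lowerVector' hE hg hk, map_smul]

/-- For `i = o`, reflection to any `j ≠ o` gives an extremal generator for which `o` is an ordinary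
index. If there is no such `j`, the positive power sums are traces and vanish. -/
theorem IsExtremal.newtonSeq_eq_zero (hE : IsCurrentRep E) (hv : IsExtremal E o n v)
    (hg : Generates E v) (hpow : ∀ i, i ≠ o → (E i o 0 ^ (n + 1)) v = 0) (i : ι) {κ c : ℕ} {u : M}
    (hu : E i i 0 u = (κ : ℂ) • u) (hc : κ < c) : newtonSeq (E i i) c u = 0 := by
  by_cases hi : i = o
  · subst hi
    by_cases h : ∃ j, j ≠ i
    · obtain ⟨j, hj⟩ := h
      exact (hv.reflect hE hj (hpow j hj)).newtonSeq_apply_eq_zero hE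
        (hv.reflect_generates hE hj hg) hj.symm hu hc
    · push Not at h
      obtain ⟨c, rfl⟩ := Nat.exists_eq_succ_of_ne_zero (Nat.ne_zero_of_lt hc)
      rw [Nat.succ_eq_add_one, CurrentWeyl.newtonSeq_eq_zero, LinearMap.zero_apply]
      intro s
      rw [← hv.sum_diag_succ hE hg s, Finset.sum_eq_single i (fun j _ hj => absurd (h j) hj)
        (by simp)]
  · exact hv.newtonSeq_apply_eq_zero hE hg hi hu hc

omit [Fintype ι] [DecidableEq ι] in
theorem adjoin_diag_eq_top (E : ι → ι → ℕ → Module.End ℂ M) :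
    Algebra.adjoin ℂ (Set.range fun x : ι × ℕ =>
      (⟨E x.1 x.1 x.2, diag_mem_diagAlgebra E x.1 x.2⟩ : diagAlgebra E)) = ⊤ := by
  have h1 := Algebra.adjoin_adjoin_coe_preimage (R := ℂ)
    (s := Set.range fun x : ι × ℕ => E x.1 x.1 x.2)
  refine Eq.trans ?_ h1
  congr 1
  ext x
  constructor
  · rintro ⟨y, rfl⟩
    exact ⟨y, rfl⟩
  · rintro ⟨y, hy⟩
    exact ⟨y, Subtype.ext hy⟩

/-- The dimension of the cyclic module generated by `w` over a commutative algebra of operators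
generated by families `h i` of power sums of `k i` elements, when all these power sums together
add up to zero. -/
theorem finrank_range_apply_le {H : Type*} [CommRing H] [Algebra ℂ H]
    (ρ : H →ₐ[ℂ] Module.End ℂ M) (w : M) (h : ι → ℕ → H)
    (hH : Algebra.adjoin ℂ (Set.range fun x : ι × ℕ => h x.1 x.2) = ⊤)
    (k : ι → ℕ) (hzero : ∀ i, ρ (h i 0) w = (k i : ℂ) • w)
    (hnewton : ∀ i c, k i < c → newtonSeq (fun s => ρ (h i s)) c w = 0)
    (hsum : ∀ s, ∑ i, h i (s + 1) = 0) :
    Module.Finite ℂ (LinearMap.range (LinearMap.applyₗ w ∘ₗ ρ.toLinearMap)) ∧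
      Module.finrank ℂ (LinearMap.range (LinearMap.applyₗ w ∘ₗ ρ.toLinearMap)) ≤
        Nat.multinomial Finset.univ k := by
  -- The annihilator of `w`. The cyclic module is `H ⧸ J`, in which the relations known on `w` hold
  -- as identities.
  let J : Ideal H :=
    { carrier := {b | ρ b w = 0}
      add_mem' := by
        intro a b ha hb
        simp_all
      zero_mem' := by simp
      smul_mem' := by
        intro c b hb
        simp_all }
  let π : H →ₐ[ℂ] H ⧸ J := Ideal.Quotient.mkₐ ℂ J
  have hπ0 : ∀ b : H, ρ b w = 0 → π b = 0 := fun b hb =>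
    Ideal.Quotient.eq_zero_iff_mem.2 hb
  have hη : ∀ i c, k i < c → newtonSeq (fun s => π (h i s)) c = 0 := by
    intro i c hc
    rw [← map_newtonSeq]
    apply hπ0
    rw [map_newtonSeq]
    exact hnewton i c hc
  -- Truncation loses nothing, because the coefficients beyond degree `k i` vanish by `hη`.
  let q : ι → Polynomial (H ⧸ J) := fun i =>
    PowerSeries.trunc (k i + 1) (PowerSeries.mk (newtonSeq fun s => π (h i s)))
  have hq : ∀ i c, (q i).coeff c = newtonSeq (fun s => π (h i s)) c := by
    intro i c
    rw [PowerSeries.coeff_trunc, PowerSeries.coeff_mk]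
    split_ifs with hc
    · rfl
    · rw [hη i c (by omega)]
  have hqc : ∀ i, (q i : PowerSeries (H ⧸ J)) =
      PowerSeries.mk (newtonSeq fun s => π (h i s)) := by
    intro i
    ext c
    rw [Polynomial.coeff_coe, hq, PowerSeries.coeff_mk]
  have hdeg : ∀ i, (q i).natDegree ≤ k i := fun i =>
    Nat.lt_succ_iff.1 (PowerSeries.natDegree_trunc_lt _ (k i))
  have hone : ∀ i, (q i).coeff 0 = 1 := fun i => by rw [hq, newtonSeq_zero]
  have hprod : ∏ i, q i = 1 := by
    apply Polynomial.coe_injective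
    rw [← Polynomial.coeToPowerSeries.ringHom_apply, map_prod]
    simp only [Polynomial.coeToPowerSeries.ringHom_apply, hqc]
    rw [prod_mk_newtonSeq_eq_one, Polynomial.coe_one]
    intro s
    rw [← map_sum, hsum, map_zero]
  have hgen : Algebra.adjoin ℂ (Set.range fun x : ι × ℕ => (q x.1).coeff x.2) = ⊤ := by
    set S := Algebra.adjoin ℂ (Set.range fun x : ι × ℕ => (q x.1).coeff x.2)
    have hS : ∀ i s, π (h i s) ∈ S := by
      intro i s
      rcases s with - | s
      -- Newton's recursion does not recover `h i 0`, but in the quotient it is the scalar `k i`.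
      · have h0 : π (h i 0 - algebraMap ℂ _ (k i : ℂ)) = 0 := by
          apply hπ0
          rw [map_sub, AlgHom.commutes, LinearMap.sub_apply, Module.algebraMap_end_apply,
            sub_eq_zero]
          exact hzero i
        rw [map_sub, sub_eq_zero] at h0
        rw [h0, AlgHom.commutes]
        exact S.algebraMap_mem _
      · refine mem_of_newtonSeq_mem (h := fun s => π (h i s)) S (fun c => ?_) s
        rw [← hq]
        exact Algebra.subset_adjoin ⟨(i, c), rfl⟩
    have hcomap : S.comap π = ⊤ := by
      rw [eq_top_iff, ← hH, Algebra.adjoin_le_iff]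
      rintro _ ⟨⟨i, s⟩, rfl⟩
      exact hS i s
    rw [eq_top_iff]
    intro y _
    obtain ⟨x, rfl⟩ := Ideal.Quotient.mk_surjective y
    have : x ∈ S.comap π := hcomap ▸ Algebra.mem_top
    exact this
  obtain ⟨hfin, hrank⟩ := finrank_le_multinomial _ q k rfl hdeg hone hprod hgen
  let Ψ : (H ⧸ J) →ₗ[ℂ] M :=
    (J.restrictScalars ℂ).liftQ (LinearMap.applyₗ w ∘ₗ ρ.toLinearMap) fun b hb => hb
  have hrange : LinearMap.range (LinearMap.applyₗ w ∘ₗ ρ.toLinearMap) = LinearMap.range Ψ :=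
    (Submodule.range_liftQ _ _ _).symm
  rw [hrange]
  exact ⟨inferInstance, Ψ.finrank_range_le.trans hrank⟩

open scoped IsMulCommutative in
theorem IsExtremal.finrank_weightPart_le (hE : IsCurrentRep E) (hv : IsExtremal E o n v)
    (hg : Generates E v) (hpow : ∀ i, i ≠ o → (E i o 0 ^ (n + 1)) v = 0) {k : ι → ℕ}
    (hk : ∑ i, k i = n) :
    Module.Finite ℂ (weightPart hE o v k) ∧
      Module.finrank ℂ (weightPart hE o v k) ≤ Nat.multinomial Finset.univ k := by
  have : IsMulCommutative (diagAlgebra E) := Algebra.isMulCommutative_adjoin ℂ (by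
    rintro _ ⟨⟨i, p⟩, rfl⟩ _ ⟨⟨l, q⟩, rfl⟩
    exact hE.diag_commute i l p q)
  have hr : weightPart hE o v k = LinearMap.range
      (LinearMap.applyₗ (lowerVector hE o v k) ∘ₗ (diagAlgebra E).val.toLinearMap) := by
    ext u
    exact ⟨fun ⟨b, hb, e⟩ => ⟨⟨b, hb⟩, e⟩, fun ⟨b, e⟩ => ⟨b, b.2, e⟩⟩
  rw [hr]
  refine finrank_range_apply_le (diagAlgebra E).val (lowerVector hE o v k)
    (fun i s => ⟨E i i s, diag_mem_diagAlgebra E i s⟩) (adjoin_diag_eq_top E) k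
    (hv.diag_zero_apply_lowerVector' hE hg hk)
    (fun i c hc => hv.newtonSeq_eq_zero hE hg hpow i
      (hv.diag_zero_apply_lowerVector' hE hg hk i) hc) fun s => Subtype.ext ?_
  rw [← Subalgebra.coe_val, map_sum]
  exact hv.sum_diag_succ hE hg s

end UpperBound

/-! ### A family of tensor products of evaluation modules and its degeneration -/

/-! ### Specialization of a lattice at `t = 0` -/

section Specialization

/-- The specialization at `t = 0` of the `ℂ[t]`-lattice generated by a vector `v` is a cyclic
module whose dimension is the rank of the lattice. -/
theorem exists_ideal_finrank_eq {U : Type*} [Ring U] [Algebra ℂ U] {V : Type*} [AddCommGroup V]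
    [Module (Polynomial ℂ) V] [Module.IsTorsionFree (Polynomial ℂ) V]
    [IsNoetherian (Polynomial ℂ) V]
    (ρ : U →+* Module.End (Polynomial ℂ) V)
    (hρ : ∀ (c : ℂ) (m : V), ρ (algebraMap ℂ U c) m = (Polynomial.C c : Polynomial ℂ) • m) (v : V) :
    ∃ I : Submodule U U, Module.Finite ℂ (U ⧸ I) ∧
      Module.finrank ℂ (U ⧸ I) = Module.finrank (Polynomial ℂ)
        (Submodule.span (Polynomial ℂ) (Set.range fun u => ρ u v)) ∧
      ∀ (u : U) (p : Polynomial ℂ), ρ u v = p • v → p.eval 0 = 0 → u ∈ I := by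
  set R := Submodule.span (Polynomial ℂ) (Set.range fun u => ρ u v) with hR
  have hstab : ∀ u, ∀ m ∈ R, ρ u m ∈ R := by
    intro u m hm
    induction hm using Submodule.span_induction with
    | mem x hx =>
      obtain ⟨u', rfl⟩ := hx
      exact Submodule.subset_span ⟨u * u', by simp⟩
    | zero => rw [map_zero]; exact Submodule.zero_mem _
    | add x y _ _ hx hy => rw [map_add]; exact Submodule.add_mem _ hx hy
    | smul c x _ hx => rw [map_smul]; exact Submodule.smul_mem _ c hx
  have : Module.Free (Polynomial ℂ) R := Module.free_of_finite_type_torsion_free'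
  let b := Module.finBasis (Polynomial ℂ) R
  -- Reduction of the free lattice modulo `t`, in coordinates.
  let χ : R →+ (Fin (Module.finrank (Polynomial ℂ) R) → ℂ) :=
    { toFun := fun m i => (b.repr m i).eval 0
      map_zero' := by ext i; simp
      map_add' := fun m m' => by ext i; simp }
  have hχ : ∀ m i, χ m i = (b.repr m i).eval 0 := fun _ _ => rfl
  have hχsmul : ∀ (p : Polynomial ℂ) m, χ (p • m) = p.eval 0 • χ m := by
    intro p m
    ext i
    simp [hχ]
  -- The kernel of the reduction is `t R`. It is stable under `U`, which makes the kernel of `ψ` a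
  -- left ideal.
  have hχ0 : ∀ m, χ m = 0 → ∃ m', m = (Polynomial.X : Polynomial ℂ) • m' := by
    intro m hm
    have hdvd : ∀ i, ∃ p, b.repr m i = Polynomial.X * p := fun i =>
      Polynomial.X_dvd_iff.2 (by
        rw [Polynomial.coeff_zero_eq_eval_zero]
        exact congrFun hm i)
    choose p hp using hdvd
    refine ⟨∑ i, p i • b i, ?_⟩
    rw [Finset.smul_sum]
    conv_lhs => rw [← b.sum_repr m]
    exact Finset.sum_congr rfl fun i _ => by rw [hp, mul_smul]
  have hvR : v ∈ R := Submodule.subset_span ⟨1, by simp⟩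
  let act : U →+ R :=
    { toFun := fun u => ⟨ρ u v, hstab u v hvR⟩
      map_zero' := Subtype.ext (by simp)
      map_add' := fun u u' => Subtype.ext (by simp) }
  have hact : ∀ u, (act u : V) = ρ u v := fun _ => rfl
  let ψ : U →ₗ[ℂ] (Fin (Module.finrank (Polynomial ℂ) R) → ℂ) :=
    { toFun := fun u => χ (act u)
      map_add' := fun u u' => by rw [map_add, map_add]
      map_smul' := fun c u => by
        have h1 : act (c • u) = (Polynomial.C c : Polynomial ℂ) • act u := by
          apply Subtype.ext
          rw [hact, Algebra.smul_def, map_mul, Module.End.mul_apply, hρ]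
          rfl
        rw [h1, hχsmul, Polynomial.eval_C]
        rfl }
  have hψu : ∀ u, ψ u = χ (act u) := fun _ => rfl
  -- The vectors `ρ u v` span `R` over `ℂ[t]`, and scalars in `ℂ[t]` reduce to scalars in `ℂ`; so
  -- their reductions already exhaust `R / t R`.
  have hψ : Function.Surjective ψ := by
    have hall : ∀ m (hm : m ∈ R), χ ⟨m, hm⟩ ∈ LinearMap.range ψ := by
      intro m hm
      induction hm using Submodule.span_induction with
      | mem x hx =>
        obtain ⟨u, rfl⟩ := hx
        exact ⟨u, rfl⟩
      | zero =>
        have := Submodule.zero_mem (LinearMap.range ψ)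
        rwa [← map_zero χ] at this
      | add x y hx hy h1 h2 =>
        have := Submodule.add_mem _ h1 h2
        rwa [← map_add] at this
      | smul c x hx h1 =>
        have := Submodule.smul_mem _ (c.eval 0) h1
        rwa [← hχsmul] at this
    intro y
    have : y = χ (∑ i, (Polynomial.C (y i) : Polynomial ℂ) • b i) := by
      ext i
      rw [hχ, b.repr_sum_self, Polynomial.eval_C]
    rw [this]
    exact hall _ (Subtype.property _)
  let I : Submodule U U :=
    { carrier := {u | ψ u = 0}
      add_mem' := fun {x y} hx hy => by
        rw [Set.mem_ofPred_eq, map_add, show ψ x = 0 from hx, show ψ y = 0 from hy, add_zero]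
      zero_mem' := map_zero ψ
      smul_mem' := by
        intro u x hx
        obtain ⟨m, hm⟩ := hχ0 (act x) hx
        have h1 : act (u • x) = (Polynomial.X : Polynomial ℂ) • ⟨ρ u m, hstab u m m.2⟩ := by
          apply Subtype.ext
          rw [hact, smul_eq_mul, map_mul, Module.End.mul_apply, ← hact, hm, Submodule.coe_smul,
            map_smul]
          rfl
        change χ (act (u • x)) = 0
        rw [h1, hχsmul, Polynomial.eval_X, zero_smul] }
  let e : (U ⧸ I) ≃ₗ[ℂ] (Fin (Module.finrank (Polynomial ℂ) R) → ℂ) :=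
    LinearEquiv.ofBijective ((I.restrictScalars ℂ).liftQ ψ fun u hu => hu)
      ⟨by
        rw [← LinearMap.ker_eq_bot]
        exact Submodule.ker_liftQ_eq_bot _ _ _ fun u hu => hu,
      fun y => by
        obtain ⟨u, rfl⟩ := hψ y
        exact ⟨I.mkQ u, rfl⟩⟩
  refine ⟨I, Module.Finite.equiv e.symm, ?_, fun u p hu hp => ?_⟩
  · rw [e.finrank_eq, Module.finrank_fin_fun]
  · change ψ u = 0
    have h1 : act u = p • ⟨v, hvR⟩ := Subtype.ext hu
    rw [hψu, h1, hχsmul, hp, zero_smul]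

end Specialization

/-! ### Representations of a current algebra from commuting representations and central characters.
-/

section SumOfRepresentations

variable {A g : Type*} [Ring A] [Algebra ℂ A] [LieRing g] [LieAlgebra ℂ g] {ι : Type*} [Fintype ι]
  (c : ι → Polynomial ℂ →ₐ[ℂ] A) (s : ι → g →ₗ[ℂ] A)

/-- The bilinear map `(P, x) ↦ ∑_j c_j(P) s_j(x)`, on the tensor product. -/
noncomputable def sumLinearMap : Current (Polynomial ℂ) g →ₗ[ℂ] A :=
  TensorProduct.lift (∑ j, (LinearMap.mul ℂ A).compl₁₂ (c j).toLinearMap (s j))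

theorem sumLinearMap_tmul (P : Polynomial ℂ) (x : g) :
    sumLinearMap c s (P ⊗ₜ[ℂ] x : Current (Polynomial ℂ) g) = ∑ j, c j P * s j x := by
  simp [sumLinearMap, LinearMap.sum_apply]

variable (hc : ∀ j P x, Commute (c j P) x) (hs : ∀ j x y, s j ⁅x, y⁆ = s j x * s j y - s j y * s j x)
  (hcomm : ∀ i j, i ≠ j → ∀ x y, Commute (s i x) (s j y))
include hc hs hcomm

/-- The cross terms `i ≠ j` cancel because the `s_j` commute with each other and the `c_j` are
central; the diagonal terms give the bracket. -/
theorem sumLinearMap_lie_tmul (P Q : Polynomial ℂ) (x y : g) :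
    sumLinearMap c s ((P * Q) ⊗ₜ[ℂ] ⁅x, y⁆ : Current (Polynomial ℂ) g) =
      sumLinearMap c s (P ⊗ₜ[ℂ] x : Current (Polynomial ℂ) g) * sumLinearMap c s (Q ⊗ₜ[ℂ] y : Current (Polynomial ℂ) g) -
        sumLinearMap c s (Q ⊗ₜ[ℂ] y : Current (Polynomial ℂ) g) * sumLinearMap c s (P ⊗ₜ[ℂ] x : Current (Polynomial ℂ) g) := by
  classical
  have hmul : ∀ i j P Q x y, (c i P * s i x) * (c j Q * s j y) =
      (c i P * c j Q) * (s i x * s j y) := fun i j P Q x y =>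
    ((hc j Q (s i x)).symm).mul_mul_mul_comm _ _
  simp only [sumLinearMap_tmul, Finset.sum_mul_sum, hmul]
  rw [Finset.sum_comm (f := fun i j => c i Q * c j P * (s i y * s j x)),
    ← Finset.sum_sub_distrib]
  refine Finset.sum_congr rfl fun i _ => ?_
  rw [← Finset.sum_sub_distrib, Finset.sum_eq_single i]
  · rw [(hc i Q (c i P)).eq, ← mul_sub, map_mul, hs]
  · intro j _ hj
    rw [(hc j Q (c i P)).eq, (hcomm i j hj.symm x y).eq, sub_self]
  · simp

/-- The sum of commuting representations `s_j` twisted by central characters `c_j`, as a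
representation of the current algebra. -/
noncomputable def sumLieHom : Current (Polynomial ℂ) g →ₗ⁅ℂ⁆ A :=
  { sumLinearMap c s with
    map_lie' := by
      intro x y
      change sumLinearMap c s ⁅x, y⁆ = ⁅sumLinearMap c s x, sumLinearMap c s y⁆
      induction x using TensorProduct.induction_on with
      | zero => rw [zero_lie, map_zero, zero_lie]
      | add x₁ x₂ h₁ h₂ => rw [add_lie, map_add, h₁, h₂, map_add, add_lie]
      | tmul P x =>
        induction y using TensorProduct.induction_on with
        | zero => rw [lie_zero, map_zero, lie_zero]
        | add y₁ y₂ h₁ h₂ => rw [lie_add, map_add, h₁, h₂, map_add, lie_add]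
        | tmul Q y =>
          rw [LieAlgebra.ExtendScalars.bracket_tmul, LieRing.of_associative_ring_bracket]
          exact sumLinearMap_lie_tmul c s hc hs hcomm P Q x y }

theorem sumLieHom_tmul (P : Polynomial ℂ) (x : g) :
    sumLieHom c s hc hs hcomm (P ⊗ₜ[ℂ] x) = ∑ j, c j P * s j x :=
  sumLinearMap_tmul c s P x

end SumOfRepresentations

/-! ### A tensor product of evaluation modules over `ℂ[t]` and its degeneration. -/

section Fusion

variable (r n : ℕ)

/-- A direct path to the additive group of `ℂ[t]`. -/
noncomputable local instance (priority := 2000) : AddCommGroup (Polynomial ℂ) := Ring.toAddCommGroup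

/-- The space `(ℂ^r)^{⊗ n} ⊗ ℂ[t]`, with basis indexed by words of length `n`. -/
abbrev TensorFamily : Type := (Fin n → Fin r) →₀ Polynomial ℂ

variable {r n}

/-- The action of a matrix on the `j`-th tensor factor. -/
noncomputable def slot (j : Fin n) (g : gl r) :
    Module.End (Polynomial ℂ) (TensorFamily r n) :=
  Finsupp.linearCombination (Polynomial ℂ) fun I =>
    ∑ a, Finsupp.single (Function.update I j a) (Polynomial.C (g a (I j)))

theorem slot_single (j : Fin n) (g : gl r) (I : Fin n → Fin r) :
    slot j g (Finsupp.single I 1) =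
      ∑ a, Finsupp.single (Function.update I j a) (Polynomial.C (g a (I j))) := by
  rw [slot, Finsupp.linearCombination_single, one_smul]

theorem slot_single' (j : Fin n) (g : gl r) (I : Fin n → Fin r) (c : Polynomial ℂ) :
    slot j g (Finsupp.single I c) =
      ∑ a, Finsupp.single (Function.update I j a) (c * Polynomial.C (g a (I j))) := by
  rw [slot, Finsupp.linearCombination_single, Finset.smul_sum]
  simp

theorem slot_ext {f g : Module.End (Polynomial ℂ) (TensorFamily r n)}
    (h : ∀ I, f (Finsupp.single I 1) = g (Finsupp.single I 1)) : f = g :=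
  Finsupp.lhom_ext' fun I => LinearMap.ext_ring (h I)

theorem slot_add (j : Fin n) (g h : gl r) : slot j (g + h) = slot j g + slot j h := by
  refine slot_ext fun I => ?_
  rw [LinearMap.add_apply, slot_single, slot_single, slot_single, ← Finset.sum_add_distrib]
  simp [Finsupp.single_add]

theorem slot_smul (j : Fin n) (c : ℂ) (g : gl r) : slot j (c • g) = c • slot j g := by
  refine slot_ext fun I => ?_
  rw [LinearMap.smul_apply, slot_single, slot_single, Finset.smul_sum]
  simp [Polynomial.smul_C]

theorem slot_mul (j : Fin n) (g h : gl r) : slot j (g * h) = slot j g * slot j h := by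
  refine slot_ext fun I => ?_
  rw [Module.End.mul_apply, slot_single, slot_single, map_sum]
  simp only [slot_single', Function.update_idem, Function.update_self, Matrix.mul_apply, map_sum,
    map_mul, Finsupp.single_finsetSum]
  rw [Finset.sum_comm]
  simp only [mul_comm]

theorem slot_commute {i j : Fin n} (hij : i ≠ j) (g h : gl r) :
    Commute (slot i g) (slot j h) := by
  refine slot_ext fun I => ?_
  rw [Module.End.mul_apply, Module.End.mul_apply, slot_single, slot_single, map_sum, map_sum]
  simp only [slot_single', Function.update_of_ne hij, Function.update_of_ne hij.symm]
  rw [Finset.sum_comm]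
  simp only [mul_comm, Function.update_comm hij]

/-- The evaluation point `j t` of the `j`-th tensor factor. -/
noncomputable def evalPoint (j : Fin n) : Polynomial ℂ := Polynomial.C (j : ℂ) * Polynomial.X

theorem evalPoint_injective : Function.Injective (evalPoint (n := n)) := by
  intro i j h
  have h1 := congrArg (fun p => Polynomial.coeff p 1) h
  simp [evalPoint] at h1
  exact Fin.ext (by exact_mod_cast h1)

/-- The operator `∑_j G(j t) g_j`, where `g_j` is the action of `g` on the `j`-th factor. -/
noncomputable def familyOperator (P : Polynomial ℂ) (g : gl r) :
    Module.End (Polynomial ℂ) (TensorFamily r n) :=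
  ∑ j, (Polynomial.aeval (evalPoint j) P : Polynomial ℂ) • slot j g

/-- The action of `ℂ[x]` in which `x` acts by `j t`. -/
noncomputable def pointCharacter (j : Fin n) :
    Polynomial ℂ →ₐ[ℂ] Module.End (Polynomial ℂ) (TensorFamily r n) :=
  (IsScalarTower.toAlgHom ℂ (Polynomial ℂ) (Module.End (Polynomial ℂ) (TensorFamily r n))).comp
    (Polynomial.aeval (evalPoint j))

theorem pointCharacter_apply (j : Fin n) (P : Polynomial ℂ) :
    pointCharacter (r := r) j P = algebraMap (Polynomial ℂ)
      (Module.End (Polynomial ℂ) (TensorFamily r n)) (Polynomial.aeval (evalPoint j) P) := rfl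

theorem pointCharacter_commute (j : Fin n) (P : Polynomial ℂ)
    (x : Module.End (Polynomial ℂ) (TensorFamily r n)) : Commute (pointCharacter j P) x := by
  rw [pointCharacter_apply]
  exact Algebra.commutes _ _

/-- `slot j` as a linear map. -/
noncomputable def slotLinearMap (j : Fin n) :
    gl r →ₗ[ℂ] Module.End (Polynomial ℂ) (TensorFamily r n) where
  toFun := slot j
  map_add' := slot_add j
  map_smul' := slot_smul j

theorem slotLinearMap_apply (j : Fin n) (g : gl r) : slotLinearMap j g = slot j g := rfl

theorem slotLinearMap_lie (j : Fin n) (g h : gl r) :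
    slotLinearMap j ⁅g, h⁆ =
      slotLinearMap j g * slotLinearMap j h - slotLinearMap j h * slotLinearMap j g := by
  rw [LieRing.of_associative_ring_bracket, map_sub]
  simp only [slotLinearMap_apply, slot_mul]

theorem slotLinearMap_commute (i j : Fin n) (hij : i ≠ j) (g h : gl r) :
    Commute (slotLinearMap i g) (slotLinearMap j h) :=
  slot_commute hij g h

variable (r n)

/-- The representation of `𝔤𝔩_r ⊗ ℂ[x]` on `(ℂ^r)^{⊗ n} ⊗ ℂ[t]` in which `x` acts on the `j`-th
factor by `j t`. -/
noncomputable def familyLieHom : Current (Polynomial ℂ) (gl r) →ₗ⁅ℂ⁆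
    Module.End (Polynomial ℂ) (TensorFamily r n) :=
  sumLieHom pointCharacter slotLinearMap pointCharacter_commute slotLinearMap_lie
    slotLinearMap_commute

theorem familyLieHom_tmul (P : Polynomial ℂ) (g : gl r) :
    familyLieHom r n (P ⊗ₜ[ℂ] g) = familyOperator P g := by
  refine (sumLieHom_tmul _ _ _ _ _ P g).trans (Finset.sum_congr rfl fun j _ => ?_)
  rw [pointCharacter_apply, slotLinearMap_apply, ← Algebra.smul_def]

/-- The action of the enveloping algebra on `(ℂ^r)^{⊗ n} ⊗ ℂ[t]`. -/
noncomputable def familyAction : UniversalEnvelopingAlgebra ℂ (Current (Polynomial ℂ) (gl r)) →ₐ[ℂ]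
    Module.End (Polynomial ℂ) (TensorFamily r n) :=
  UniversalEnvelopingAlgebra.lift ℂ (familyLieHom r n)

theorem familyAction_ι (P : Polynomial ℂ) (g : gl r) :
    familyAction r n (UniversalEnvelopingAlgebra.ι ℂ (P ⊗ₜ[ℂ] g)) = familyOperator P g := by
  rw [familyAction, UniversalEnvelopingAlgebra.lift_ι_apply, familyLieHom_tmul]

variable [NeZero r]

/-- The vector `e_1 ⊗ ⋯ ⊗ e_1`. -/
noncomputable def familyVector : TensorFamily r n := Finsupp.single (fun _ => 0) 1

theorem slot_familyVector (j : Fin n) (g : borel r) :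
    slot j (g : gl r) (familyVector r n) = (g : gl r) 0 0 • familyVector r n := by
  rw [familyVector, slot_single, Finset.sum_eq_single 0]
  · rw [Function.update_eq_self_iff.2 rfl, Finsupp.smul_single, Algebra.smul_def, mul_one]
    rfl
  · intro a _ ha
    rw [g.2 a 0 (Fin.pos_iff_ne_zero.2 ha), Polynomial.C_0, Finsupp.single_zero]
  · simp

/-- The `ℂ[t]`-lattice generated by `e_1 ⊗ ⋯ ⊗ e_1`. -/
noncomputable def familyLattice : Submodule (Polynomial ℂ) (TensorFamily r n) :=
  Submodule.span (Polynomial ℂ) (Set.range fun u => familyAction r n u (familyVector r n))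

variable {r n}

theorem familyAction_mem_lattice (u : UniversalEnvelopingAlgebra ℂ (Current (Polynomial ℂ) (gl r)))
    {m : TensorFamily r n} (hm : m ∈ familyLattice r n) :
    familyAction r n u m ∈ familyLattice r n := by
  unfold familyLattice at hm
  induction hm using Submodule.span_induction with
  | mem x hx =>
    obtain ⟨u', rfl⟩ := hx
    refine Submodule.subset_span ⟨u * u', ?_⟩
    simp only [map_mul, Module.End.mul_apply]
  | zero => rw [map_zero]; exact Submodule.zero_mem _
  | add x y _ _ hx hy => rw [map_add]; exact Submodule.add_mem _ hx hy
  | smul c x _ hx => rw [map_smul]; exact Submodule.smul_mem _ c hx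

theorem familyVector_mem_lattice : familyVector r n ∈ familyLattice r n :=
  Submodule.subset_span ⟨1, by simp⟩

/-- Powers of the point `j t` come from `x^s ⊗ g`, and coefficients in `t` from the `ℂ[t]`-structure
of the lattice. Allowing `G` over `ℂ[t]` is essential, since the interpolation nodes depend on `t`.
-/
theorem sum_eval_smul_slot_mem_lattice (G : Polynomial (Polynomial ℂ)) (g : gl r)
    {m : TensorFamily r n} (hm : m ∈ familyLattice r n) :
    ∑ j, G.eval (evalPoint j) • slot j g m ∈ familyLattice r n := by
  induction G using Polynomial.induction_on' with
  | add p q hp hq =>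
    simp only [Polynomial.eval_add, add_smul, Finset.sum_add_distrib]
    exact Submodule.add_mem _ hp hq
  | monomial s c =>
    have h1 := familyAction_mem_lattice
      (UniversalEnvelopingAlgebra.ι ℂ ((Polynomial.X ^ s : Polynomial ℂ) ⊗ₜ[ℂ] g)) hm
    have h2 := Submodule.smul_mem _ c h1
    rw [familyAction_ι, familyOperator, LinearMap.sum_apply, Finset.smul_sum] at h2
    refine (congrArg (· ∈ familyLattice r n) (Finset.sum_congr rfl fun j _ => ?_)).mpr h2
    rw [Polynomial.eval_monomial, LinearMap.smul_apply, smul_smul, map_pow, Polynomial.aeval_X]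

/-- The value at the `j`-th point of the interpolation polynomial that vanishes at all the other
points. -/
noncomputable def nodeProd (j : Fin n) : Polynomial ℂ :=
  ∏ l ∈ Finset.univ.erase j, (evalPoint j - evalPoint l)

theorem nodeProd_ne_zero (j : Fin n) : nodeProd j ≠ 0 :=
  Finset.prod_ne_zero_iff.2 fun _ hl =>
    sub_ne_zero.2 fun h => Finset.ne_of_mem_erase hl (evalPoint_injective h).symm

/-- Lagrange interpolation without division: `∏_{l ≠ j} (x - l t)` vanishes at all points except the
`j`-th and isolates that slot. -/
theorem nodeProd_smul_slot_mem_lattice (j : Fin n) (g : gl r) {m : TensorFamily r n}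
    (hm : m ∈ familyLattice r n) : nodeProd j • slot j g m ∈ familyLattice r n := by
  have h := sum_eval_smul_slot_mem_lattice
    (∏ l ∈ Finset.univ.erase j, (Polynomial.X - Polynomial.C (evalPoint l))) g hm
  rw [Finset.sum_eq_single j] at h
  · simpa [Polynomial.eval_prod, nodeProd] using h
  · intro i _ hi
    rw [Polynomial.eval_prod, Finset.prod_eq_zero (Finset.mem_erase.2 ⟨hi, Finset.mem_univ i⟩)
      (by simp), zero_smul]
  · simp

theorem prod_nodeProd_smul_single_mem_lattice (I : Fin n → Fin r) :
    (∏ j : Fin n, nodeProd j) • Finsupp.single I 1 ∈ familyLattice r n := by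
  have key : ∀ s : Finset (Fin n), (∏ j ∈ s, nodeProd j) •
      Finsupp.single (s.piecewise I fun _ => 0) 1 ∈ familyLattice r n := by
    intro s
    induction s using Finset.induction_on with
    | empty =>
      rw [Finset.prod_empty, one_smul, Finset.piecewise_empty]
      exact familyVector_mem_lattice
    | insert j s hj ih =>
      -- This matrix unit turns the `j`-th factor from the first basis vector into the one with
      -- index `I j`.
      have h := nodeProd_smul_slot_mem_lattice j (Matrix.single (I j) 0 1) ih
      rw [map_smul, slot_single, Finset.sum_eq_single (I j), ← Finset.piecewise_insert, smul_smul,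
        ← Finset.prod_insert hj, Finset.piecewise_eq_of_notMem _ _ _ hj, Matrix.single_apply_same,
        Polynomial.C_1] at h
      · exact h
      · intro a _ ha
        rw [Matrix.single_apply_of_row_ne ha.symm, Polynomial.C_0, Finsupp.single_zero]
      · simp
  simpa using key Finset.univ

/-- A nonzero polynomial multiplies the whole free module of rank `r ^ n` into the lattice, and this
multiplication is injective. -/
theorem pow_le_finrank_lattice :
    r ^ n ≤ Module.finrank (Polynomial ℂ) (familyLattice r n) := by
  set c : Polynomial ℂ := ∏ j : Fin n, nodeProd j with hc
  have hc0 : c ≠ 0 := Finset.prod_ne_zero_iff.2 fun j _ => nodeProd_ne_zero j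
  have hmem : ∀ m : TensorFamily r n, c • m ∈ familyLattice r n := by
    intro m
    induction m using Finsupp.induction_linear with
    | zero => rw [smul_zero]; exact Submodule.zero_mem _
    | add x y hx hy => rw [smul_add]; exact Submodule.add_mem _ hx hy
    | single I p =>
      have h := Submodule.smul_mem _ p (prod_nodeProd_smul_single_mem_lattice I)
      rwa [smul_comm, Finsupp.smul_single, smul_eq_mul, mul_one] at h
  have h := LinearMap.finrank_le_finrank_of_injective
    (f := ((c • LinearMap.id : Module.End (Polynomial ℂ) (TensorFamily r n))).codRestrict
      (familyLattice r n) hmem)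
    (by
      intro x y hxy
      exact smul_right_injective _ hc0 (congrArg Subtype.val hxy))
  rw [Module.finrank_finsupp_self] at h
  simpa using h

theorem familyOperator_familyVector (P : Polynomial ℂ) (x : borel r) :
    familyOperator P (x : gl r) (familyVector r n) =
      (∑ j : Fin n, (Polynomial.aeval (evalPoint j) P : Polynomial ℂ) *
        Polynomial.C ((x : gl r) 0 0)) • familyVector r n := by
  rw [familyOperator, LinearMap.sum_apply, Finset.sum_smul]
  refine Finset.sum_congr rfl fun j _ => ?_
  rw [LinearMap.smul_apply, slot_familyVector, mul_smul,
    ← algebraMap_smul (Polynomial ℂ) ((x : gl r) 0 0)]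
  rfl

omit [NeZero r] in
theorem algebraMap_end_apply_eq_C_smul (c : ℂ) (m : TensorFamily r n) :
    algebraMap ℂ (Module.End (Polynomial ℂ) (TensorFamily r n)) c m =
      (Polynomial.C c : Polynomial ℂ) • m := by
  rw [Module.algebraMap_end_apply, ← algebraMap_smul (Polynomial ℂ) c]
  rfl

theorem eval_zero_aeval_evalPoint (j : Fin n) (P : Polynomial ℂ) :
    (Polynomial.aeval (evalPoint j) P : Polynomial ℂ).eval 0 = P.eval 0 := by
  rw [← Polynomial.coe_aeval_eq_eval, ← Polynomial.aeval_algHom_apply]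
  simp [evalPoint, Polynomial.coe_aeval_eq_eval]

theorem smul_omegaOne_diagPart (x : borel r) :
    ((n • omegaOne r) ∘ₗ diagPart r) x = n * (x : gl r) 0 0 := by
  change n • (Matrix.diagonal (Matrix.diag (x : gl r)) 0 0) = _
  simp

theorem evalZero_apply (P : Polynomial ℂ) : evalZero P = P.eval 0 := by
  rw [evalZero, Polynomial.coe_aeval_eq_eval]

/-- There is a finite-dimensional cyclic highest weight module of weight `n ω_1` and dimension at
least `r ^ n`: the degeneration at `t = 0` of a tensor product of evaluation modules. -/
theorem exists_ideal_pow_le_finrank (r n : ℕ) [NeZero r] :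
    ∃ I : Submodule (UniversalEnvelopingAlgebra ℂ (Current (Polynomial ℂ) (gl r)))
        (UniversalEnvelopingAlgebra ℂ (Current (Polynomial ℂ) (gl r))),
      Module.Finite ℂ (UniversalEnvelopingAlgebra ℂ (Current (Polynomial ℂ) (gl r)) ⧸ I) ∧
      IsHighestWeightVector evalZero ((n • omegaOne r) ∘ₗ diagPart r) (I.mkQ 1) ∧
      r ^ n ≤ Module.finrank ℂ
        (UniversalEnvelopingAlgebra ℂ (Current (Polynomial ℂ) (gl r)) ⧸ I) := by
  obtain ⟨I, hfin, hrank, hI⟩ := exists_ideal_finrank_eq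
    (familyAction r n).toRingHom
    (fun c m => by
      rw [AlgHom.toRingHom_eq_coe, RingHom.coe_coe, AlgHom.commutes,
        algebraMap_end_apply_eq_C_smul])
    (familyVector r n)
  refine ⟨I, hfin, (isHighestWeightVector_mkQ_iff _ _ I).2 fun x P => ?_,
    hrank ▸ pow_le_finrank_lattice⟩
  -- The scalar by which the defining relation acts on the generating vector. At `t = 0` all `n`
  -- points become 0, so each summand contributes `P(0) x_{00}` and the difference vanishes.
  refine hI _ (∑ j : Fin n, (Polynomial.aeval (evalPoint j) P : Polynomial ℂ) *
    Polynomial.C ((x : gl r) 0 0) - Polynomial.C (n * (x : gl r) 0 0 * P.eval 0)) ?_ ?_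
  · rw [AlgHom.toRingHom_eq_coe, RingHom.coe_coe, map_sub, familyAction_ι, AlgHom.commutes,
      LinearMap.sub_apply, familyOperator_familyVector, algebraMap_end_apply_eq_C_smul,
      smul_omegaOne_diagPart, evalZero_apply, sub_smul]
  · simp only [Polynomial.eval_sub, Polynomial.eval_finsetSum, Polynomial.eval_mul,
      eval_zero_aeval_evalPoint, Polynomial.eval_C, Finset.sum_const, Finset.card_univ,
      Fintype.card_fin, nsmul_eq_mul]
    ring

end Fusion

/-! ### Matrix units of the current algebra -/

section MatrixUnits

variable {r : ℕ}

/-- The element `x ^ p ⊗ e_{ij}` of `𝔤𝔩_r ⊗ ℂ[x]`. -/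
noncomputable def currentUnit (i j : Fin r) (p : ℕ) : Current (Polynomial ℂ) (gl r) :=
  (Polynomial.X ^ p : Polynomial ℂ) ⊗ₜ[ℂ] (Matrix.single i j 1 : gl r)

theorem lie_currentUnit (a b c d : Fin r) (p q : ℕ) :
    ⁅currentUnit a b p, currentUnit c d q⁆ =
      (if b = c then currentUnit a d (p + q) else 0) -
        (if d = a then currentUnit c b (p + q) else 0) := by
  have h1 : ∀ a b c d : Fin r, (Matrix.single a b (1 : ℂ) * Matrix.single c d 1 : gl r) =
      if b = c then Matrix.single a d 1 else 0 := by
    intro a b c d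
    split_ifs with h
    · subst h; simp
    · simp [h]
  have h2 : ⁅(Matrix.single a b 1 : gl r), (Matrix.single c d 1 : gl r)⁆ =
      (if b = c then Matrix.single a d 1 else 0) - (if d = a then Matrix.single c b 1 else 0) := by
    rw [LieRing.of_associative_ring_bracket, h1, h1]
  unfold currentUnit
  rw [LieAlgebra.ExtendScalars.bracket_tmul, h2, TensorProduct.tmul_sub, ← pow_add]
  congr 1 <;> split_ifs <;> simp

variable (M : Type*) [AddCommGroup M] [Module ℂ M] [LieRingModule (Current (Polynomial ℂ) (gl r)) M]
  [LieModule ℂ (Current (Polynomial ℂ) (gl r)) M]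

/-- The operator by which `x ^ p ⊗ e_{ij}` acts on a module. -/
noncomputable def currentOp (i j : Fin r) (p : ℕ) : Module.End ℂ M :=
  LieModule.toEnd ℂ (Current (Polynomial ℂ) (gl r)) M (currentUnit i j p)

variable {M}

theorem currentOp_apply (i j : Fin r) (p : ℕ) (m : M) :
    currentOp M i j p m = ⁅currentUnit i j p, m⁆ := rfl

theorem isCurrentRep_currentOp : IsCurrentRep (currentOp (r := r) M) := by
  intro a b c d p q
  ext m
  have h := leibniz_lie (currentUnit a b p) (currentUnit c d q) m
  rw [lie_currentUnit, sub_lie] at h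
  simp only [Module.End.mul_apply, LinearMap.add_apply, LinearMap.sub_apply, currentOp_apply]
  rw [h]
  split_ifs <;> simp [currentOp_apply] <;> abel

theorem generates_currentOp {v : M}
    (hv : LieSubmodule.lieSpan ℂ (Current (Polynomial ℂ) (gl r)) {v} = ⊤) :
    Generates (currentOp (r := r) M) v := by
  intro S hvS hS
  have key : ∀ (x : Current (Polynomial ℂ) (gl r)), ∀ m ∈ S, ⁅x, m⁆ ∈ S := by
    intro x m hm
    induction x using TensorProduct.induction_on with
    | zero => rw [zero_lie]; exact S.zero_mem
    | add x y hx hy => rw [add_lie]; exact S.add_mem hx hy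
    | tmul P g =>
      induction P using Polynomial.induction_on' with
      | add P Q hP hQ => rw [TensorProduct.add_tmul, add_lie]; exact S.add_mem hP hQ
      | monomial p c =>
        rw [Matrix.matrix_eq_sum_single g]
        simp only [TensorProduct.tmul_sum, sum_lie]
        refine S.sum_mem fun i _ => S.sum_mem fun j _ => ?_
        have h : ((Polynomial.monomial p c : Polynomial ℂ) ⊗ₜ[ℂ]
            (Matrix.single i j (g i j) : gl r) : Current (Polynomial ℂ) (gl r)) =
            (c * g i j) • currentUnit i j p := by
          rw [← Polynomial.C_mul_X_pow_eq_monomial, ← Polynomial.smul_eq_C_mul, currentUnit,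
            mul_comm, mul_smul, TensorProduct.smul_tmul', ← TensorProduct.tmul_smul]
          simp [Matrix.smul_single]
        rw [h, smul_lie]
        exact S.smul_mem _ (hS i j p m hm)
  let N : LieSubmodule ℂ (Current (Polynomial ℂ) (gl r)) M :=
    { S with lie_mem := fun {x m} hm => key x m hm }
  have hN : N = ⊤ := by
    rw [eq_top_iff, ← hv, LieSubmodule.lieSpan_le]
    rintro _ rfl
    exact hvS
  exact congrArg LieSubmodule.toSubmodule hN

/-- Demanded by the definition of an `sl₂`-triple; detected by setting `x = 0` and reading off the
entry `(a, a)`. -/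
theorem currentUnit_diag_sub_ne_zero {a b : Fin r} (hab : a ≠ b) :
    currentUnit a a 0 - currentUnit b b 0 ≠ 0 := by
  intro h
  have := congrArg (fun x => TensorProduct.lid ℂ (gl r)
    (LinearMap.rTensor (gl r) evalZero.toLinearMap x) a a) h
  simp [currentUnit, TensorProduct.lid_tmul, hab.symm] at this

theorem isSl2Triple_currentUnit {a b : Fin r} (hab : a ≠ b) :
    IsSl2Triple (currentUnit a a 0 - currentUnit b b 0) (currentUnit a b 0) (currentUnit b a 0)
    where
  h_ne_zero := currentUnit_diag_sub_ne_zero hab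
  lie_e_f := by simp [lie_currentUnit]
  lie_h_e_nsmul := by simp [sub_lie, lie_currentUnit, hab.symm, two_smul]
  lie_h_f_nsmul := by simp [lie_currentUnit, hab, two_smul, sub_eq_add_neg]

/-- In a finite-dimensional module, a vector of weight `m` for the `sl₂` attached to `a ≠ b` that is
killed by the raising operator is killed by the `(m + 1)`-st power of the lowering operator. -/
theorem currentOp_pow_apply_eq_zero [Module.Finite ℂ M] {a b : Fin r} (hab : a ≠ b) {m : ℕ} {v : M}
    (hh : ⁅currentUnit a a 0 - currentUnit b b 0, v⁆ = (m : ℂ) • v)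
    (he : ⁅currentUnit a b 0, v⁆ = 0) : (currentOp M b a 0 ^ (m + 1)) v = 0 := by
  rcases eq_or_ne v 0 with rfl | hv
  · simp
  · exact IsSl2Triple.HasPrimitiveVectorWith.pow_toEnd_f_eq_zero_of_eq_nat
      (t := isSl2Triple_currentUnit hab) ⟨hv, hh, he⟩ rfl

end MatrixUnits

/-! ### The highest weight vector of the Weyl module -/

section HighestWeight

variable {r n : ℕ} [NeZero r]

theorem IsHighestWeightVector.lie_currentUnit {M : Type*} [AddCommGroup M] [Module ℂ M]
    [LieRingModule (Current (Polynomial ℂ) (gl r)) M] {v : M}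
    (hv : IsHighestWeightVector evalZero ((n • omegaOne r) ∘ₗ diagPart r) v) {a b : Fin r}
    (hab : a ≤ b) (p : ℕ) :
    ⁅currentUnit a b p, v⁆ = (if b = 0 ∧ p = 0 then (n : ℂ) else 0) • v := by
  have hmem : (Matrix.single a b 1 : gl r) ∈ borel r := by
    intro i j hij
    rw [Matrix.single_apply, if_neg]
    rintro ⟨rfl, rfl⟩
    exact absurd hij (not_lt.2 hab)
  have h := hv ⟨_, hmem⟩ (Polynomial.X ^ p)
  rw [smul_omegaOne_diagPart, evalZero_apply] at h
  rw [currentUnit, h]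
  congr 1
  rcases eq_or_ne b 0 with rfl | hb
  · obtain rfl : a = 0 := le_antisymm hab (Fin.zero_le _)
    rcases eq_or_ne p 0 with rfl | hp
    · simp
    · simp [hp]
  · simp [hb]

theorem toEnd_pow_mkQ_one {L : Type*} [LieRing L] [LieAlgebra ℂ L]
    (I : Submodule (UniversalEnvelopingAlgebra ℂ L) (UniversalEnvelopingAlgebra ℂ L)) (x : L)
    (m : ℕ) : (LieModule.toEnd ℂ L (UniversalEnvelopingAlgebra ℂ L ⧸ I) x ^ m) (I.mkQ 1) =
      I.mkQ (UniversalEnvelopingAlgebra.ι ℂ x ^ m) := by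
  induction m with
  | zero => simp
  | succ m ih =>
    rw [pow_succ', Module.End.mul_apply, ih, LieModule.toEnd_apply_apply, lie_quot_def, ← map_smul,
      smul_eq_mul, pow_succ']

/-- Finiteness of the Weyl module is not yet available here, so `sl₂`-theory is applied in each
finite-dimensional `U / I` and the relation passes to the intersection of the ideals. The exponent
is one more than the `sl₂`-weight, which is `n` for `b = 0` and 0 otherwise. -/
theorem currentOp_pow_weylVector {a b : Fin r} (hba : b < a) :
    (currentOp (WeylOne r (n • omegaOne r)) a b 0 ^ ((if b = 0 then n else 0) + 1))
      (weylVector evalZero ((n • omegaOne r) ∘ₗ diagPart r)) = 0 := by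
  rw [weylVector, currentOp, toEnd_pow_mkQ_one, Submodule.mkQ_apply,
    Submodule.Quotient.mk_eq_zero]
  refine Submodule.mem_sInf.2 fun I hI => ?_
  obtain ⟨hfin, hhw⟩ := hI
  rw [← Submodule.Quotient.mk_eq_zero, ← Submodule.mkQ_apply, ← toEnd_pow_mkQ_one]
  refine currentOp_pow_apply_eq_zero hba.ne ?_ ?_
  · have ha : a ≠ 0 := (lt_of_le_of_lt (Fin.zero_le b) hba).ne'
    rw [sub_lie, hhw.lie_currentUnit le_rfl, hhw.lie_currentUnit le_rfl]
    simp [ha]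
  · have ha : a ≠ 0 := (lt_of_le_of_lt (Fin.zero_le b) hba).ne'
    rw [hhw.lie_currentUnit hba.le]
    simp [ha]

variable (r n)

theorem isExtremal_weylVector :
    IsExtremal (currentOp (r := r) (WeylOne r (n • omegaOne r))) 0 n
      (weylVector evalZero ((n • omegaOne r) ∘ₗ diagPart r)) := by
  have hw := weylVector_isHighestWeightVector evalZero ((n • omegaOne r) ∘ₗ diagPart r)
  refine ⟨fun a b p hb => ?_, ?_, fun p => ?_⟩
  · rcases le_or_gt a b with hab | hab
    · rw [currentOp_apply, hw.lie_currentUnit hab]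
      simp [hb]
    -- For `a > b ≠ 0` the `sl₂`-weight is 0, so `e_{ab} v = 0`. The bracket with `x^p e_{aa}`,
    -- which also kills `v`, gives `x^p e_{ab} v = 0`.
    · have ha : a ≠ 0 := (lt_of_le_of_lt (Fin.zero_le b) hab).ne'
      have h0 := currentOp_pow_weylVector (n := n) hab
      rw [if_neg hb, zero_add, pow_one, currentOp_apply] at h0
      have h := leibniz_lie (currentUnit a a p) (currentUnit a b 0)
        (weylVector evalZero ((n • omegaOne r) ∘ₗ diagPart r))
      rw [h0, hw.lie_currentUnit le_rfl, CurrentWeyl.lie_currentUnit] at h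
      simpa [ha, hab.ne, currentOp_apply] using h.symm
  · rw [currentOp_apply, hw.lie_currentUnit le_rfl]
    simp
  · rw [currentOp_apply, hw.lie_currentUnit le_rfl]
    simp

theorem generates_weylVector :
    Generates (currentOp (r := r) (WeylOne r (n • omegaOne r)))
      (weylVector evalZero ((n • omegaOne r) ∘ₗ diagPart r)) :=
  generates_currentOp (lieSpan_weylVector _ _)

theorem currentOp_pow_succ_weylVector (i : Fin r) (hi : i ≠ 0) :
    (currentOp (WeylOne r (n • omegaOne r)) i 0 0 ^ (n + 1))
      (weylVector evalZero ((n • omegaOne r) ∘ₗ diagPart r)) = 0 := by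
  simpa using currentOp_pow_weylVector (n := n) (Fin.pos_iff_ne_zero.2 hi)

/-- The part of the Weyl module of weight `∑ k_i ε_i`. -/
noncomputable def weylPart (k : Fin r → ℕ) : Submodule ℂ (WeylOne r (n • omegaOne r)) :=
  weightPart isCurrentRep_currentOp 0 (weylVector evalZero ((n • omegaOne r) ∘ₗ diagPart r)) k

theorem iSup_weylPart : ⨆ k ∈ Finset.piAntidiag Finset.univ n, weylPart r n k = ⊤ :=
  IsExtremal.iSup_weightPart_piAntidiag _ (isExtremal_weylVector r n) (generates_weylVector r n)
    (currentOp_pow_succ_weylVector r n)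

variable {r n}

theorem finrank_weylPart_le {k : Fin r → ℕ} (hk : ∑ i, k i = n) :
    Module.Finite ℂ (weylPart r n k) ∧
      Module.finrank ℂ (weylPart r n k) ≤ Nat.multinomial Finset.univ k :=
  IsExtremal.finrank_weightPart_le _ (isExtremal_weylVector r n) (generates_weylVector r n)
    (currentOp_pow_succ_weylVector r n) hk

end HighestWeight

/-! ### Weight spaces -/

theorem iSupIndep_iInf_eigenspace {κ R M : Type*} [CommRing R] [IsDomain R] [AddCommGroup M]
    [Module R M] [Module.IsTorsionFree R M] {f : κ → Module.End R M}
    (hf : ∀ i j, Commute (f i) (f j)) :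
    iSupIndep fun χ : κ → R => ⨅ i, (f i).eigenspace (χ i) := by
  have h := Module.End.independent_iInf_maxGenEigenspace_of_forall_mapsTo f fun i j φ =>
    Module.End.mapsTo_maxGenEigenspace_of_comm (hf j i) φ
  refine h.mono fun χ => iInf_mono fun i => ?_
  exact Module.End.genEigenspace_le_maximal (f i) (χ i) 1

theorem cartan_lie_eq_zero {r : ℕ} (x y : cartan r) : ⁅(x : gl r), (y : gl r)⁆ = 0 := by
  have hx : Matrix.diagonal (Matrix.diag (x : gl r)) = x := Matrix.IsDiag.diagonal_diag x.2
  have hy : Matrix.diagonal (Matrix.diag (y : gl r)) = y := Matrix.IsDiag.diagonal_diag y.2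
  rw [LieRing.of_associative_ring_bracket, ← hx, ← hy, Matrix.diagonal_mul_diagonal,
    Matrix.diagonal_mul_diagonal, sub_eq_zero]
  simp only [mul_comm]

theorem iSupIndep_weightSpace (r : ℕ) (M : Type*) [AddCommGroup M] [Module ℂ M]
    [LieRingModule (Current (Polynomial ℂ) (gl r)) M]
    [LieModule ℂ (Current (Polynomial ℂ) (gl r)) M] :
    iSupIndep fun μ : Module.Dual ℂ (cartan r) => weightSpace (Polynomial ℂ) M μ := by
  have hf : ∀ x y : cartan r, Commute
      (LieModule.toEnd ℂ (Current (Polynomial ℂ) (gl r)) M ((1 : Polynomial ℂ) ⊗ₜ[ℂ] (x : gl r)))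
      (LieModule.toEnd ℂ (Current (Polynomial ℂ) (gl r)) M
        ((1 : Polynomial ℂ) ⊗ₜ[ℂ] (y : gl r))) := by
    intro x y
    rw [commute_iff_lie_eq, ← LieHom.map_lie, LieAlgebra.ExtendScalars.bracket_tmul,
      cartan_lie_eq_zero, TensorProduct.tmul_zero, map_zero]
  exact (iSupIndep_iInf_eigenspace hf).comp (f := fun (μ : Module.Dual ℂ (cartan r)) x => μ x)
    DFunLike.coe_injective

theorem epsilon_apply {r : ℕ} (i : Fin r) (x : cartan r) : epsilon i x = (x : gl r) i i := rfl

theorem weylPart_le_weightSpace {r n : ℕ} [NeZero r] {k : Fin r → ℕ} (hk : ∑ i, k i = n) :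
    weylPart r n k ≤ weightSpace (Polynomial ℂ) (WeylOne r (n • omegaOne r))
      (∑ i, k i • epsilon i) := by
  intro u hu
  rw [mem_weightSpace]
  intro x
  have hd : ∀ i, ⁅currentUnit i i 0, u⁆ = (k i : ℂ) • u := fun i =>
    IsExtremal.diag_zero_apply_of_mem _ (isExtremal_weylVector r n) (generates_weylVector r n) hk
      hu i
  have hx : ((1 : Polynomial ℂ) ⊗ₜ[ℂ] (x : gl r) : Current (Polynomial ℂ) (gl r)) =
      ∑ i, ((x : gl r) i i) • currentUnit i i 0 := by
    have hx : Matrix.diagonal (Matrix.diag (x : gl r)) = x := Matrix.IsDiag.diagonal_diag x.2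
    have hs : (x : gl r) = ∑ i, (x : gl r) i i • (Matrix.single i i 1 : gl r) := by
      conv_lhs => rw [← hx, ← Matrix.sum_single_eq_diagonal]
      simp [Matrix.smul_single]
    conv_lhs => rw [hs]
    rw [TensorProduct.tmul_sum]
    refine Finset.sum_congr rfl fun i _ => ?_
    rw [TensorProduct.tmul_smul, currentUnit, pow_zero]
  rw [hx, sum_lie]
  simp only [smul_lie, hd, smul_smul, ← Finset.sum_smul]
  congr 1
  simp [epsilon_apply, mul_comm]

theorem sum_smul_epsilon_injective (r : ℕ) :
    Function.Injective fun k : Fin r → ℕ => (∑ i, k i • epsilon i : Module.Dual ℂ (cartan r)) := by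
  intro k l h
  funext i
  have := LinearMap.congr_fun h ⟨Matrix.diagonal (Pi.single i 1), Matrix.isDiag_diagonal _⟩
  simpa [epsilon_apply, Pi.single_apply] using this

/-! ### Dimensions -/

theorem finite_and_finrank_sup_le_sum {κ K M : Type*} [DivisionRing K] [AddCommGroup M]
    [Module K M] (s : Finset κ) {N : κ → Submodule K M} {f : κ → ℕ}
    (h : ∀ k ∈ s, Module.Finite K (N k) ∧ Module.finrank K (N k) ≤ f k) :
    Module.Finite K (⨆ k ∈ s, N k : Submodule K M) ∧
      Module.finrank K (⨆ k ∈ s, N k : Submodule K M) ≤ ∑ k ∈ s, f k := by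
  classical
  induction s using Finset.induction_on with
  | empty =>
    rw [show (⨆ k ∈ (∅ : Finset κ), N k) = ⊥ by simp]
    exact ⟨inferInstance, by simp⟩
  | insert a s ha ih =>
    obtain ⟨h1, h2⟩ := ih fun k hk => h k (Finset.mem_insert_of_mem hk)
    obtain ⟨h3, h4⟩ := h a (Finset.mem_insert_self a s)
    rw [Finset.iSup_insert, Finset.sum_insert ha]
    exact ⟨Submodule.finite_sup _ _,
      (Submodule.finrank_add_le_finrank_add_finrank _ _).trans (add_le_add h4 h2)⟩

/-- If subspaces with dimensions bounded by `f k` span a space of dimension at least `∑ f k`, then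
all the bounds are attained. -/
theorem finrank_eq_of_iSup_eq_top {κ K M : Type*} [DivisionRing K] [AddCommGroup M]
    [Module K M] {s : Finset κ} {N : κ → Submodule K M} {f : κ → ℕ}
    (h : ∀ k ∈ s, Module.Finite K (N k) ∧ Module.finrank K (N k) ≤ f k)
    (htop : ⨆ k ∈ s, N k = ⊤) (hle : ∑ k ∈ s, f k ≤ Module.finrank K M) {k : κ} (hk : k ∈ s) :
    Module.finrank K (N k) = f k := by
  have h1 := (finite_and_finrank_sup_le_sum s (f := fun k => Module.finrank K (N k))
    fun k hk => ⟨(h k hk).1, le_rfl⟩).2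
  rw [htop, finrank_top] at h1
  exact (Finset.sum_eq_sum_iff_of_le fun k hk => (h k hk).2).1
    (le_antisymm (Finset.sum_le_sum fun k hk => (h k hk).2) (hle.trans h1)) k hk

/-- The multinomial theorem for `(1 + ⋯ + 1) ^ n`. -/
theorem sum_multinomial (r n : ℕ) :
    ∑ k ∈ Finset.piAntidiag (Finset.univ : Finset (Fin r)) n, Nat.multinomial Finset.univ k =
      r ^ n := by
  have h := Finset.sum_pow_eq_sum_piAntidiag (R := ℕ) (Finset.univ : Finset (Fin r)) (fun _ => 1) n
  simpa using h.symm

variable (r n : ℕ) [NeZero r]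

theorem finite_weylOne_and_finrank_le :
    Module.Finite ℂ (WeylOne r (n • omegaOne r)) ∧
      Module.finrank ℂ (WeylOne r (n • omegaOne r)) ≤ r ^ n := by
  have h := finite_and_finrank_sup_le_sum (Finset.piAntidiag (Finset.univ : Finset (Fin r)) n)
    (N := weylPart r n) (f := Nat.multinomial Finset.univ)
    fun k hk => finrank_weylPart_le (Finset.mem_piAntidiag.1 hk).1
  rw [iSup_weylPart, finrank_top, sum_multinomial] at h
  have := h.1
  exact ⟨Module.Finite.equiv (Submodule.topEquiv (R := ℂ)), h.2⟩

theorem pow_le_finrank_weylOne : r ^ n ≤ Module.finrank ℂ (WeylOne r (n • omegaOne r)) := by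
  obtain ⟨I, hfin, hhw, hle⟩ := exists_ideal_pow_le_finrank r n
  -- Needed first: comparing `finrank` along a surjection requires a finite-dimensional source.
  have := (finite_weylOne_and_finrank_le r n).1
  have hI : weylIdeal evalZero ((n • omegaOne r) ∘ₗ diagPart r) ≤ I := sInf_le ⟨hfin, hhw⟩
  refine hle.trans (LinearMap.finrank_le_finrank_of_surjective
    (f := (Submodule.factor hI).restrictScalars ℂ) ?_)
  exact Submodule.factor_surjective hI

theorem finrank_weylPart {k : Fin r → ℕ} (hk : ∑ i, k i = n) :
    Module.finrank ℂ (weylPart r n k) = Nat.multinomial Finset.univ k :=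
  finrank_eq_of_iSup_eq_top (fun _ hk => finrank_weylPart_le (Finset.mem_piAntidiag.1 hk).1)
    (iSup_weylPart r n) ((sum_multinomial r n).trans_le (pow_le_finrank_weylOne r n))
    (Finset.mem_piAntidiag.2 ⟨hk, fun _ _ => Finset.mem_univ _⟩)

/-- The parts lie in the corresponding weight spaces, which are independent, and together they span;
so they fill the weight spaces. For `μ` not of the form `∑ k_i ε_i` with `∑ k_i = n` the supremum is
empty and the weight space is zero. -/
theorem weightSpace_weylOne (μ : Module.Dual ℂ (cartan r)) :
    weightSpace (Polynomial ℂ) (WeylOne r (n • omegaOne r)) μ =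
      ⨆ (k : Fin r → ℕ) (_ : ∑ i, k i = n ∧ ∑ i, k i • epsilon i = μ), weylPart r n k := by
  symm
  refine eq_of_le_of_iSupIndep
    (T := fun μ => ⨆ (k : Fin r → ℕ) (_ : ∑ i, k i = n ∧ ∑ i, k i • epsilon i = μ), weylPart r n k)
    (iSupIndep_weightSpace r (WeylOne r (n • omegaOne r))) (fun μ => ?_) ?_ μ
  · refine iSup₂_le fun k hk => ?_
    rw [← hk.2]
    exact weylPart_le_weightSpace hk.1
  · rw [eq_top_iff, ← iSup_weylPart]
    refine iSup₂_le fun k hk => ?_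
    exact le_iSup_of_le (∑ i, k i • epsilon i)
      (le_iSup₂_of_le k ⟨(Finset.mem_piAntidiag.1 hk).1, rfl⟩ le_rfl)

theorem weightSpace_weylOne_sum {k : Fin r → ℕ} (hk : ∑ i, k i = n) :
    weightSpace (Polynomial ℂ) (WeylOne r (n • omegaOne r)) (∑ i, k i • epsilon i) =
      weylPart r n k := by
  rw [weightSpace_weylOne]
  refine le_antisymm (iSup₂_le fun l hl => ?_) (le_iSup₂_of_le k ⟨hk, rfl⟩ le_rfl)
  rw [sum_smul_epsilon_injective r hl.2]

end CurrentWeyl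

theorem corollary2p3 (r n : ℕ) [NeZero r] :
    Module.Finite ℂ (CurrentWeyl.WeylOne r (n • CurrentWeyl.omegaOne r)) ∧
    Module.finrank ℂ (CurrentWeyl.WeylOne r (n • CurrentWeyl.omegaOne r)) = r ^ n ∧
    (∀ k : Fin r → ℕ, ∑ i, k i = n →
      (Module.finrank ℂ (CurrentWeyl.weightSpace (Polynomial ℂ)
        (CurrentWeyl.WeylOne r (n • CurrentWeyl.omegaOne r))
        (∑ i, k i • CurrentWeyl.epsilon i)) : ℚ) = (Nat.factorial n : ℚ) / ∏ i, (Nat.factorial (k i) : ℚ)) ∧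
    (∀ μ : Module.Dual ℂ (CurrentWeyl.cartan r),
      (¬ ∃ k : Fin r → ℕ, ∑ i, k i = n ∧ μ = ∑ i, k i • CurrentWeyl.epsilon i) →
      Module.finrank ℂ (CurrentWeyl.weightSpace (Polynomial ℂ)
        (CurrentWeyl.WeylOne r (n • CurrentWeyl.omegaOne r)) μ) = 0) := by
  obtain ⟨hfin, hle⟩ := CurrentWeyl.finite_weylOne_and_finrank_le r n
  refine ⟨hfin, le_antisymm hle (CurrentWeyl.pow_le_finrank_weylOne r n), fun k hk => ?_,
    fun μ hμ => ?_⟩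
  · rw [CurrentWeyl.weightSpace_weylOne_sum r n hk, CurrentWeyl.finrank_weylPart r n hk]
    have h := Nat.multinomial_spec Finset.univ k
    rw [hk] at h
    rw [eq_div_iff (Finset.prod_ne_zero_iff.2 fun i _ => Nat.cast_ne_zero.2 (k i).factorial_ne_zero),
      ← h]
    push_cast
    ring
  · have h : CurrentWeyl.weightSpace (Polynomial ℂ)
        (CurrentWeyl.WeylOne r (n • CurrentWeyl.omegaOne r)) μ = ⊥ := by
      rw [CurrentWeyl.weightSpace_weylOne, iSup₂_eq_bot]
      exact fun k hk => absurd ⟨k, hk.1, hk.2.symm⟩ hμ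
    rw [h, finrank_bot]
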